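/- Let $\mathcal N$ be an inhomogeneous Poisson point process on $(0,\infty)$ with rate function $\mu$, where $\mu>0$ Lebesgue-almost everywhere on $(0,\infty)$ and $\int_0^t\mu(s)\,ds<\infty$ for every $t<\infty$. Let $0<T_1<T_2<\cdots$ be the epochs of $\mathcal N$, with $T_0=0$ and $T_n=\infty$ if $\mathcal N$ has fewer than $n$ points, and let \[D=\min\{T_n:\ T_n<\infty,\ T_{n+1}-T_n\ge 1\}\in[0,\infty]\] be the start of the first gap of length at least $1$ ($D=\infty$ if there is no such gap). Let $a>0$ and suppose that \[\mu(t)=\log t+\log\log t-\log a\qquad\text{for all sufficiently large } t .\] Then $\mathbb E D^p<\infty$ for every real $0\le p<a$, and $\mathbb E D^p=\infty$ for every real $p>a$. Moreover, let $\mu'$ be another rate function with $\mu'>0$ almost everywhere on $(0,\infty)$ and $\int_0^t\mu'(s)\,ds<\infty$ for every $t<\infty$, and let $D'$ be the corresponding start of the first gap of length at least $1$ in a Poisson process $\mathcal N'$ with rate function $\mu'$. If $\mu'(t)\le\mu(t)$ for all sufficiently large $t$, then $\mathbb E D'^p<\infty$ for every real $0\le p<a$. If $\mu'(t)\ge\mu(t)$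 for all sufficiently large $t$, then $\mathbb E D'^p=\infty$ for every real $p>a$. -/

import Mathlib

open MeasureTheory ProbabilityTheory Filter Set
open scoped ENNReal

noncomputable section

/-- The standing assumptions on the rate function `μ` on `(0, ∞)`: `M(0, t) = ∫₀ᵗ μ(s) ds < ∞` for
every `t` (in particular `μ` is Lebesgue measurable), and `μ > 0` almost everywhere. -/
structure IsRateFunction (μ : ℝ → ℝ) : Prop where
  integrableOn : ∀ t : ℝ, IntegrableOn μ (Ioc 0 t)
  pos : ∀ᵐ t ∂(volume.restrict (Ioi (0 : ℝ))), 0 < μ t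

/-- The intensity measure `M(dt) = μ(t) dt` on `(0, ∞)`. -/
def intensity (μ : ℝ → ℝ) : Measure ℝ :=
  (volume.restrict (Ioi (0 : ℝ))).withDensity fun t => ENNReal.ofReal (μ t)

/-- The random set `N` is a Poisson point process on `(0, ∞)` with rate function `μ`: the number of
points in a Borel set of finite intensity is Poisson distributed with parameter the intensity of
the set, and the numbers of points in disjoint Borel sets are independent. -/
structure IsPoissonProcess {Ω : Type*} [MeasurableSpace Ω] (P : Measure Ω) (μ : ℝ → ℝ)
    (N : Ω → Set ℝ) : Prop where
  subset : ∀ ω, N ω ⊆ Ioi 0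
  measurable_count : ∀ B : Set ℝ, MeasurableSet B → Measurable fun ω => (N ω ∩ B).encard
  count_law : ∀ B : Set ℝ, MeasurableSet B → intensity μ B ≠ ∞ → ∀ k : ℕ,
    P {ω | (N ω ∩ B).encard = k} = poissonMeasure (intensity μ B).toNNReal {k}
  indep : ∀ (n : ℕ) (B : Fin n → Set ℝ), (∀ i, MeasurableSet (B i)) →
    Pairwise (fun i j => Disjoint (B i) (B j)) →
    iIndepFun (fun i ω => (N ω ∩ B i).encard) P

/-- The epochs `T₀ = 0 < T₁ < T₂ < ⋯` of a set `S ⊆ (0, ∞)` of points; `Tₙ = ∞` if `S` has fewer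
than `n` points. -/
def epoch (S : Set ℝ) : ℕ → ℝ≥0∞
  | 0 => 0
  | n + 1 => sInf {t | ∃ s ∈ S, t = ENNReal.ofReal s ∧ epoch S n < t}

/-- The start `D = min {Tₙ : Tₙ₊₁ - Tₙ ≥ ℓ}` of the first gap of length `ℓ`, with `D = ∞` if there
is no such gap. -/
def firstGap (ℓ : ℝ) (S : Set ℝ) : ℝ≥0∞ :=
  sInf {t | ∃ n : ℕ, t = epoch S n ∧ epoch S n + ENNReal.ofReal ℓ ≤ epoch S (n + 1)}

/-- The moment `E Dᵖ ∈ [0, ∞]` of the start `D` of the first gap of length `ℓ` in `N`. -/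
def gapMoment {Ω : Type*} [MeasurableSpace Ω] (P : Measure Ω) (ℓ : ℝ) (N : Ω → Set ℝ) (p : ℝ) :
    ℝ≥0∞ :=
  ∫⁻ ω, firstGap ℓ (N ω) ^ p ∂P

end

/-! A gap starts near time `t` when a point there (rate `μ`) is followed by an empty unit interval
(probability about `exp (-μ)`). For the critical rate `exp (-μ t) = a / (t log t)` and `μ t ~ log
t`, so this hazard is about `a / t` and `P(D > t)` decays like `t ^ (-a + o(1))`; hence the
threshold `p = a`.

To make this exact, time after a large `t₀` is cut into cells of length `1 / m`, whose emptiness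
events are independent. A run of `m` empty cells forces a gap, while the absence of runs of `m - 2`
empty cells excludes one. Write `V n i` for `survProb k q n i 0`. It satisfies `V (n+k+1) i = V
(n+k) (i+1) - h i * V n (i+k+1)` (`survProb_recursion`), where `h i`, the probability of a run of
`k` broken by the next cell, is about `a / (m t)`. Since `V n (i+k+1) ≥ V (n+k) (i+1)`, iterating
gives a power upper bound (`survProb_le_rpow`). The reverse inequality up to a factor `1 + ε`
(`survProb_le_mul_survProb`) gives the lower bound (`rpow_le_survProb`).

Survival is antitone in the cell probabilities (`survProb_anti`), so any rate below or above the
critical one is compared with it cell by cell; this covers `μ'` as well as `μ`. Up to time `t₀` a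
gap is excluded with positive probability by requiring finitely many coarse cells to be occupied.
The tail bounds become moment statements by a dyadic sum and by Markov's inequality. -/

/-! ### Runs of consecutive indices. -/

/-- No run of `k` consecutive indices with `E` occurs among `i, …, i + n - 1`, if the indices
before `i` end with a run of length `r`. -/
def Surv (k : ℕ) (E : ℕ → Prop) : ℕ → ℕ → ℕ → Prop
  | 0, _, r => r < k
  | n + 1, i, r => r < k ∧ ((¬ E i ∧ Surv k E n (i + 1) 0) ∨ (E i ∧ Surv k E n (i + 1) (r + 1)))

/-- The probability of `Surv` for independent events with probabilities `q i`. -/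
noncomputable def survProb (k : ℕ) (q : ℕ → ℝ) : ℕ → ℕ → ℕ → ℝ
  | 0, _, r => if r < k then 1 else 0
  | n + 1, i, r => if r < k then
      (1 - q i) * survProb k q n (i + 1) 0 + q i * survProb k q n (i + 1) (r + 1) else 0

theorem Surv.lt {k : ℕ} {E : ℕ → Prop} {n i r : ℕ} (h : Surv k E n i r) : r < k := by
  cases n with
  | zero => exact h
  | succ n => exact h.1

theorem Surv.add_lt {k : ℕ} {E : ℕ → Prop} {n : ℕ} : ∀ {i r c : ℕ}, Surv k E n i r → c ≤ n →
    (∀ j, i ≤ j → j < i + c → E j) → r + c < k := by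
  induction n with
  | zero =>
    intro i r c h hc _
    obtain rfl : c = 0 := by omega
    exact h
  | succ n ih =>
    intro i r c h hc hE
    rcases c with _ | c
    · exact h.1
    rcases h.2 with ⟨h1, _⟩ | ⟨_, h2⟩
    · exact absurd (hE i le_rfl (by omega)) h1
    · have := ih h2 (c := c) (by omega) fun j hj hj' => hE j (by omega) (by omega)
      omega

theorem Surv.exists_not {k : ℕ} {E : ℕ → Prop} {n : ℕ} : ∀ {i r l : ℕ}, Surv k E n i r → i ≤ l →
    l + k ≤ i + n → ∃ j, l ≤ j ∧ j < l + k ∧ ¬ E j := by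
  induction n with
  | zero =>
    intro i r l h hl hk
    have : r < k := h
    omega
  | succ n ih =>
    intro i r l h hl hk
    rcases hl.eq_or_lt with rfl | hl
    · by_contra! hcon
      have := h.add_lt (c := k) (by omega) hcon
      omega
    · rcases h.2 with ⟨_, h2⟩ | ⟨_, h2⟩
      · exact ih h2 hl (by omega)
      · exact ih h2 hl (by omega)

theorem exists_run_of_not_surv {k : ℕ} {E : ℕ → Prop} {n : ℕ} : ∀ {i r : ℕ}, r ≤ k → r ≤ i →
    (∀ j, i - r ≤ j → j < i → E j) → ¬ Surv k E n i r →
    ∃ l, l + k ≤ i + n ∧ ∀ j, l ≤ j → j < l + k → E j := by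
  have base : ∀ {n i r : ℕ}, r = k → r ≤ i → (∀ j, i - r ≤ j → j < i → E j) →
      ∃ l, l + k ≤ i + n ∧ ∀ j, l ≤ j → j < l + k → E j := by
    intro n i r hr hi hE
    exact ⟨i - r, by omega, fun j hj hj' => hE j hj (by omega)⟩
  induction n with
  | zero =>
    intro i r hr hi hE h
    exact base (by simp only [Surv] at h; omega) hi hE
  | succ n ih =>
    intro i r hr hi hE h
    rcases hr.eq_or_lt with hr | hr
    · exact base hr hi hE
    by_cases hi' : E i
    · have h2 : ¬ Surv k E n (i + 1) (r + 1) := fun h2 => h ⟨hr, Or.inr ⟨hi', h2⟩⟩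
      obtain ⟨l, hl, hl'⟩ := ih (by omega) (by omega) (fun j hj hj' => by
        rcases Nat.lt_succ_iff_lt_or_eq.1 hj' with hj'' | rfl
        · exact hE j (by omega) hj''
        · exact hi') h2
      exact ⟨l, by omega, hl'⟩
    · have h2 : ¬ Surv k E n (i + 1) 0 := fun h2 => h ⟨hr, Or.inl ⟨hi', h2⟩⟩
      obtain ⟨l, hl, hl'⟩ := ih (by omega) (by omega) (fun j hj hj' => by omega) h2
      exact ⟨l, by omega, hl'⟩

/-! ### Recursions for the probability of having no run. -/

section survProb

variable {k : ℕ} {q : ℕ → ℝ}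

theorem survProb_of_le {n i r : ℕ} (h : k ≤ r) : survProb k q n i r = 0 := by
  cases n <;> simp [survProb, h]

theorem survProb_succ {n i r : ℕ} (h : r < k) : survProb k q (n + 1) i r =
    (1 - q i) * survProb k q n (i + 1) 0 + q i * survProb k q n (i + 1) (r + 1) := by
  simp [survProb, h]

theorem survProb_nonneg (h0 : ∀ i, 0 ≤ q i) (h1 : ∀ i, q i ≤ 1) (n : ℕ) :
    ∀ i r, 0 ≤ survProb k q n i r := by
  induction n with
  | zero => intro i r; simp only [survProb]; split_ifs <;> norm_num
  | succ n ih =>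
    intro i r
    simp only [survProb]
    split_ifs
    · exact add_nonneg (mul_nonneg (sub_nonneg.2 (h1 i)) (ih _ _)) (mul_nonneg (h0 i) (ih _ _))
    · exact le_rfl

theorem survProb_succ_le_self (h0 : ∀ i, 0 ≤ q i) (h1 : ∀ i, q i ≤ 1) (n : ℕ) :
    ∀ i r, survProb k q n i (r + 1) ≤ survProb k q n i r := by
  induction n with
  | zero => intro i r; simp only [survProb]; split_ifs <;> first | omega | norm_num
  | succ n ih =>
    intro i r
    by_cases h : r + 1 < k
    · rw [survProb_succ h, survProb_succ (by omega)]
      have := mul_le_mul_of_nonneg_left (ih (i + 1) (r + 1)) (h0 i)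
      linarith
    · rw [survProb_of_le (by omega : k ≤ r + 1)]
      exact survProb_nonneg h0 h1 _ _ _

theorem survProb_le_zero_run (h0 : ∀ i, 0 ≤ q i) (h1 : ∀ i, q i ≤ 1) (n i r : ℕ) :
    survProb k q n i r ≤ survProb k q n i 0 :=
  antitone_nat_of_succ_le (f := survProb k q n i) (survProb_succ_le_self h0 h1 n i) (Nat.zero_le r)

/-- A larger `q i` moves weight from run length `0` to run length `r + 1`, from which survival is
less likely. -/
theorem survProb_anti {q' : ℕ → ℝ} (h0 : ∀ i, 0 ≤ q i) (h1 : ∀ i, q i ≤ 1)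
    (h0' : ∀ i, 0 ≤ q' i) (h1' : ∀ i, q' i ≤ 1) (N : ℕ) (h : ∀ i < N, q i ≤ q' i) (n : ℕ) :
    ∀ i r, i + n ≤ N → survProb k q' n i r ≤ survProb k q n i r := by
  induction n with
  | zero => intro i r _; simp [survProb]
  | succ n ih =>
    intro i r hN
    simp only [survProb]
    split_ifs
    · have e1 := mul_le_mul_of_nonneg_left (ih (i + 1) 0 (by omega)) (sub_nonneg.2 (h1' i))
      have e2 := mul_le_mul_of_nonneg_left (ih (i + 1) (r + 1) (by omega)) (h0' i)
      have e3 := mul_nonneg (sub_nonneg.2 (h i (by omega)))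
        (sub_nonneg.2 (survProb_le_zero_run (k := k) h0 h1 n (i + 1) (r + 1)))
      linarith
    · exact le_rfl

theorem survProb_step_le (h0 : ∀ i, 0 ≤ q i) (h1 : ∀ i, q i ≤ 1) (hk : 0 < k) (n i : ℕ) :
    survProb k q (n + 1) i 0 ≤ survProb k q n (i + 1) 0 := by
  rw [survProb_succ hk]
  have := mul_le_mul_of_nonneg_left (survProb_le_zero_run (k := k) h0 h1 n (i + 1) 1) (h0 i)
  linarith

theorem survProb_steps_le (h0 : ∀ i, 0 ≤ q i) (h1 : ∀ i, q i ≤ 1) (hk : 0 < k) (n : ℕ) :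
    ∀ l i, survProb k q (n + l) i 0 ≤ survProb k q n (i + l) 0 := by
  intro l
  induction l with
  | zero => intro i; exact le_rfl
  | succ l ih =>
    intro i
    refine (survProb_step_le h0 h1 hk (n + l) i).trans ((ih (i + 1)).trans_eq ?_)
    rw [add_right_comm, add_assoc]

theorem survProb_eq_one (n : ℕ) : ∀ i r, n + r < k → survProb k q n i r = 1 := by
  induction n with
  | zero => intro i r h; simp only [survProb]; rw [if_pos (by omega)]
  | succ n ih =>
    intro i r h
    rw [survProb_succ (by omega), ih _ _ (by omega), ih _ _ (by omega)]
    ring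

/-- Histories with current runs `r` and `r + 1` merge at the first failure, so their difference
persists only along `s` successes in a row. -/
theorem survProb_sub (n s : ℕ) : ∀ i r, r + s < k →
    survProb k q (n + s) i r - survProb k q (n + s) i (r + 1) =
      (∏ l ∈ Finset.range s, q (i + l)) *
        (survProb k q n (i + s) (r + s) - survProb k q n (i + s) (r + s + 1)) := by
  induction s with
  | zero => intro i r _; simp
  | succ s ih =>
    intro i r h
    rw [← add_assoc, survProb_succ (by omega), survProb_succ (by omega), Finset.prod_range_succ']
    have := ih (i + 1) (r + 1) (by omega)
    have e : ∀ l, i + 1 + l = i + (l + 1) := fun l => by omega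
    simp only [e] at this
    rw [show r + (s + 1) = r + 1 + s by omega, add_zero]
    linear_combination q i * this

/-- Surviving from `i + 1` but not from `i` means that `i, …, i + k - 1` is a run, that `i + k`
breaks it, and that the remaining `n` indices survive on their own. -/
theorem survProb_recursion (hk : 0 < k) (n i : ℕ) :
    survProb k q (n + k + 1) i 0 = survProb k q (n + k) (i + 1) 0 -
      (∏ l ∈ Finset.range k, q (i + l)) * (1 - q (i + k)) * survProb k q n (i + k + 1) 0 := by
  obtain ⟨s, rfl⟩ : ∃ s, k = s + 1 := ⟨k - 1, by omega⟩
  have h := survProb_sub (k := s + 1) (q := q) (n + 1) s (i + 1) 0 (by omega)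
  rw [survProb_of_le (i := i + 1 + s) (by omega : s + 1 ≤ 0 + s + 1),
    survProb_succ (i := i + 1 + s) (by omega : 0 + s < s + 1),
    survProb_of_le (i := i + 1 + s + 1) (by omega : s + 1 ≤ 0 + s + 1)] at h
  rw [survProb_succ hk, Finset.prod_range_succ']
  have e : ∀ l, i + 1 + l = i + (l + 1) := fun l => by omega
  rw [show n + (s + 1) = n + 1 + s by omega]
  simp only [e, add_zero] at h ⊢
  rw [show i + (s + 1) + 1 = i + (s + 1 + 1) by omega]
  linear_combination q i * (-h)

theorem survProb_self (hk : 0 < k) (i : ℕ) :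
    survProb k q k i 0 = 1 - ∏ l ∈ Finset.range k, q (i + l) := by
  obtain ⟨s, rfl⟩ : ∃ s, k = s + 1 := ⟨k - 1, by omega⟩
  have h := survProb_sub (k := s + 1) (q := q) 0 s (i + 1) 0 (by omega)
  have e : ∀ l, i + 1 + l = i + (l + 1) := fun l => by omega
  rw [survProb_of_le (i := i + 1 + s) (by omega : s + 1 ≤ 0 + s + 1),
    survProb_eq_one 0 _ (0 + s) (by omega), survProb_eq_one _ _ _ (by omega)] at h
  rw [survProb_succ hk, Finset.prod_range_succ', survProb_eq_one _ _ _ (by omega)]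
  simp only [e, add_zero, zero_add] at h ⊢
  linear_combination q i * (-h)

end survProb

theorem survProb_one (q : ℕ → ℝ) (n : ℕ) : ∀ i,
    survProb 1 q n i 0 = ∏ l ∈ Finset.range n, (1 - q (i + l)) := by
  induction n with
  | zero => intro i; simp [survProb]
  | succ n ih =>
    intro i
    rw [survProb_succ one_pos, survProb_of_le (k := 1) (r := 0 + 1) (by norm_num), ih,
      Finset.prod_range_succ']
    simp only [add_zero, mul_zero, add_assoc, add_comm 1, mul_comm (1 - q i)]

/-! ### Survival of independent events. -/

section measure_surv

variable {Ω : Type*}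

theorem setOf_surv_succ {k r : ℕ} (E : ℕ → Set Ω) (n i : ℕ) (h : r < k) :
    {ω | Surv k (fun j => ω ∈ E j) (n + 1) i r} =
      ((E i)ᶜ ∩ {ω | Surv k (fun j => ω ∈ E j) n (i + 1) 0}) ∪
        (E i ∩ {ω | Surv k (fun j => ω ∈ E j) n (i + 1) (r + 1)}) := by
  ext ω
  simp [Surv, h]

/-- The σ-algebra is a parameter so that it can be the one generated by a block of the events, which
yields independence of disjoint blocks. -/
theorem measurableSet_surv {m : MeasurableSpace Ω} (k : ℕ) (E : ℕ → Set Ω) (n : ℕ) :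
    ∀ i r, (∀ j, i ≤ j → j < i + n → MeasurableSet (E j)) →
      MeasurableSet {ω | Surv k (fun j => ω ∈ E j) n i r} := by
  induction n with
  | zero => intro i r _; exact MeasurableSet.const _
  | succ n ih =>
    intro i r hE
    by_cases h : r < k
    · rw [setOf_surv_succ E n i h]
      have hi := hE i le_rfl (by omega)
      have h' : ∀ j, i + 1 ≤ j → j < i + 1 + n → MeasurableSet (E j) :=
        fun j hj hj' => hE j (by omega) (by omega)
      exact (hi.compl.inter (ih _ _ h')).union (hi.inter (ih _ _ h'))
    · convert MeasurableSet.empty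
      ext ω
      simp [Surv, h]

variable {E : ℕ → Set Ω}

theorem measureReal_inter_of_iIndepSet [MeasurableSpace Ω] {P : Measure Ω}
    (hm : ∀ j, MeasurableSet (E j)) (hE : iIndepSet E P)
    {S T : Set ℕ} (hST : Disjoint S T) {A B : Set Ω}
    (hA : MeasurableSet[MeasurableSpace.generateFrom {t | ∃ n ∈ S, E n = t}] A)
    (hB : MeasurableSet[MeasurableSpace.generateFrom {t | ∃ n ∈ T, E n = t}] B) :
    P.real (A ∩ B) = P.real A * P.real B := by
  have := (Indep_iff _ _ P).1 (hE.indep_generateFrom_of_disjoint hm S T hST) A B hA hB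
  rw [measureReal_def, this, ENNReal.toReal_mul]; rfl

theorem measurableSet_generateFrom_mem {S : Set ℕ} {j : ℕ} (hj : j ∈ S) :
    MeasurableSet[MeasurableSpace.generateFrom {t | ∃ n ∈ S, E n = t}] (E j) :=
  MeasurableSpace.measurableSet_generateFrom ⟨j, hj, rfl⟩

theorem measureReal_surv [MeasurableSpace Ω] {P : Measure Ω} [IsProbabilityMeasure P]
    {q : ℕ → ℝ} (hm : ∀ j, MeasurableSet (E j)) (hE : iIndepSet E P)
    (hq : ∀ j, P.real (E j) = q j) (k n : ℕ) : ∀ i r,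
    P.real {ω | Surv k (fun j => ω ∈ E j) n i r} = survProb k q n i r := by
  induction n with
  | zero =>
    intro i r
    simp only [Surv, survProb]
    split_ifs with h <;> simp [h]
  | succ n ih =>
    intro i r
    by_cases h : r < k
    · have hd : Disjoint ({i} : Set ℕ) (Ici (i + 1)) := by simp
      have hB : ∀ r', MeasurableSet[MeasurableSpace.generateFrom {t | ∃ n ∈ Ici (i + 1), E n = t}]
          {ω | Surv k (fun j => ω ∈ E j) n (i + 1) r'} := fun r' =>
        @measurableSet_surv Ω _ k E n (i + 1) r' fun j hj _ => measurableSet_generateFrom_mem hj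
      have hA := measurableSet_generateFrom_mem (E := E) (mem_singleton i)
      have hB' : ∀ r', MeasurableSet {ω | Surv k (fun j => ω ∈ E j) n (i + 1) r'} :=
        fun r' => measurableSet_surv k E n _ _ fun j _ _ => hm j
      rw [setOf_surv_succ E n i h, measureReal_union
        (disjoint_compl_left.mono inter_subset_left inter_subset_left) ((hm i).inter (hB' _)),
        measureReal_inter_of_iIndepSet hm hE hd hA.compl (hB _),
        measureReal_inter_of_iIndepSet hm hE hd hA (hB _), probReal_compl_eq_one_sub (hm i),
        ih, ih, hq, survProb_succ h]
    · rw [survProb_of_le (by omega)]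
      convert measureReal_empty
      ext ω
      simp [Surv, h]

theorem measureReal_surv_inter_surv [MeasurableSpace Ω] {P : Measure Ω}
    [IsProbabilityMeasure P] {q : ℕ → ℝ} (hm : ∀ j, MeasurableSet (E j))
    (hE : iIndepSet E P) (hq : ∀ j, P.real (E j) = q j) (k k' c n : ℕ) :
    P.real ({ω | Surv k' (fun j => ω ∈ E j) c 0 0} ∩ {ω | Surv k (fun j => ω ∈ E j) n c 0}) =
      survProb k' q c 0 0 * survProb k q n c 0 := by
  have hd : Disjoint (Iio c) (Ici c) := by
    rw [Set.disjoint_left]; intro j hj hj'; exact absurd (mem_Iio.1 hj) (not_lt.2 hj')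
  rw [measureReal_inter_of_iIndepSet hm hE hd, measureReal_surv hm hE hq,
    measureReal_surv hm hE hq]
  · exact @measurableSet_surv Ω _ k' E c 0 0 fun j _ hj =>
      measurableSet_generateFrom_mem (by simpa using hj)
  · exact @measurableSet_surv Ω _ k E n c 0 fun j hj _ => measurableSet_generateFrom_mem hj

end measure_surv

/-! ### Void probabilities, local finiteness and independence of cells. -/

section Poisson

variable {Ω : Type*} [MeasurableSpace Ω] {P : Measure Ω} {μ : ℝ → ℝ}
  {N : Ω → Set ℝ}

theorem IsPoissonProcess.measurableSet_void (hN : IsPoissonProcess P μ N) {B : Set ℝ}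
    (hB : MeasurableSet B) : MeasurableSet {ω | N ω ∩ B = ∅} := by
  have := hN.measurable_count B hB (measurableSet_singleton (0 : ℕ∞))
  convert this using 1
  ext ω
  simp

theorem IsPoissonProcess.measureReal_void (hN : IsPoissonProcess P μ N) {B : Set ℝ}
    (hB : MeasurableSet B) (h : intensity μ B ≠ ∞) :
    P.real {ω | N ω ∩ B = ∅} = Real.exp (-(intensity μ B).toReal) := by
  have h0 := hN.count_law B hB h 0
  rw [poissonMeasure_singleton] at h0
  simp only [Nat.cast_zero, encard_eq_zero] at h0
  rw [measureReal_def, h0, ENNReal.toReal_ofReal (by positivity)]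
  simp [ENNReal.coe_toNNReal_eq_toReal]

theorem IsPoissonProcess.ae_finite [IsProbabilityMeasure P] (hN : IsPoissonProcess P μ N) {B : Set ℝ}
    (hB : MeasurableSet B) (h : intensity μ B ≠ ∞) : ∀ᵐ ω ∂P, (N ω ∩ B).Finite := by
  have hm : ∀ k : ℕ, MeasurableSet {ω | (N ω ∩ B).encard = k} := fun k =>
    hN.measurable_count B hB (measurableSet_singleton (k : ℕ∞))
  have h1 : P (⋃ k : ℕ, {ω | (N ω ∩ B).encard = k}) = 1 := by
    rw [measure_iUnion _ hm]
    · simp_rw [hN.count_law B hB h]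
      rw [← measure_univ (μ := poissonMeasure (intensity μ B).toNNReal)]
      rw [← Measure.tsum_indicator_apply_singleton _ univ MeasurableSet.univ]
      simp only [indicator_univ]
    · intro i j hij
      rw [Function.onFun, Set.disjoint_left]
      intro ω hi hj
      simp only [mem_ofPred_eq] at hi hj
      rw [hi] at hj
      exact hij (by exact_mod_cast hj)
  have h2 := (prob_compl_eq_zero_iff (MeasurableSet.iUnion hm)).2 h1
  filter_upwards [compl_mem_ae_iff.2 h2] with ω hω
  rw [compl_compl, mem_iUnion] at hω
  obtain ⟨k, hk⟩ := hω
  exact finite_of_encard_eq_coe hk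

theorem IsPoissonProcess.iIndepSet_void (hN : IsPoissonProcess P μ N) {s : ℕ → ℝ}
    (hs : Monotone s) : iIndepSet (fun i => {ω | N ω ∩ Ioc (s i) (s (i + 1)) = ∅}) P := by
  rw [iIndepSet_iff_meas_biInter fun i => hN.measurableSet_void measurableSet_Ioc]
  intro S
  obtain ⟨n, hn⟩ : ∃ n, ∀ m ∈ S, m < n := ⟨S.sup id + 1, fun m hm =>
    Nat.lt_succ_of_le (Finset.le_sup (f := id) hm)⟩
  have hd := hs.pairwise_disjoint_on_Ioc_succ
  have hi := hN.indep n (fun i => Ioc (s i) (s (i + 1))) (fun i => measurableSet_Ioc)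
    (fun i j hij => hd (fun h => hij (Fin.ext h)))
  have := hi.measure_inter_preimage_eq_mul (S.attachFin hn) (sets := fun _ => {0})
    fun i _ => measurableSet_singleton _
  have e : ∀ i : ℕ, {ω | N ω ∩ Ioc (s i) (s (i + 1)) = ∅} =
      (fun ω => (N ω ∩ Ioc (s i) (s (i + 1))).encard) ⁻¹' {0} := fun i => by ext ω; simp
  simp_rw [e]
  have hp : ∀ f : ℕ → ℝ≥0∞, ∏ i ∈ S, f i = ∏ i ∈ S.attachFin hn, f i := fun f => by
    conv_lhs => rw [← Finset.map_valEmbedding_attachFin hn, Finset.prod_map]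
    rfl
  rw [hp, ← this]
  congr 1
  ext ω
  simp only [mem_iInter, Finset.mem_attachFin]
  exact ⟨fun h i hi => h i hi, fun h i hi => h ⟨i, hn i hi⟩ hi⟩

end Poisson

/-! ### Epochs and the first gap of a fixed set of points. -/

/-- If all epochs were at most `s`, finiteness up to `s + 1` would make each infimum attained, and
the epochs would increase strictly inside a finite set. -/
theorem exists_lt_epoch {S : Set ℝ} {s : ℝ} (hs : 0 ≤ s) (hS : S ⊆ Ioi 0)
    (hfin : (S ∩ Ioc 0 (s + 1)).Finite) :
    ∃ n, ENNReal.ofReal s < epoch S n := by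
  by_contra! hcon
  have key : ∀ n, epoch S n < epoch S (n + 1) ∧
      epoch S (n + 1) ∈ ENNReal.ofReal '' (S ∩ Ioc 0 (s + 1)) := by
    intro n
    set A : Set ℝ≥0∞ := {t | ∃ s ∈ S, t = ENNReal.ofReal s ∧ epoch S n < t} with hA
    have hepoch : epoch S (n + 1) = sInf A := rfl
    have hsub : A ∩ Iic (ENNReal.ofReal (s + 1)) ⊆ ENNReal.ofReal '' (S ∩ Ioc 0 (s + 1)) := by
      rintro t ⟨⟨y, hy, rfl, -⟩, ht⟩
      have hy0 : 0 < y := hS hy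
      refine ⟨y, ⟨hy, hy0, ?_⟩, rfl⟩
      by_contra! h
      exact absurd ht (not_le.2 ((ENNReal.ofReal_lt_ofReal_iff hy0).2 h))
    have hfinA := (hfin.image ENNReal.ofReal).subset hsub
    have hne : (A ∩ Iic (ENNReal.ofReal (s + 1))).Nonempty := by
      by_contra hne
      rw [not_nonempty_iff_eq_empty] at hne
      have hle : ENNReal.ofReal (s + 1) ≤ sInf A := by
        refine le_sInf fun t ht => ?_
        by_contra! h
        have : t ∈ A ∩ Iic (ENNReal.ofReal (s + 1)) := ⟨ht, h.le⟩
        rw [hne] at this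
        exact this
      have h1 := hcon (n + 1)
      rw [hepoch] at h1
      have h2 := hle.trans h1
      exact absurd h2 (not_le.2 ((ENNReal.ofReal_lt_ofReal_iff (by linarith)).2 (by linarith)))
    obtain ⟨c, hc, hmin⟩ := hfinA.exists_minimal hne
    have hleast : sInf A = c := by
      refine le_antisymm (sInf_le hc.1) (le_sInf fun t ht => ?_)
      rcases le_total c t with h | h
      · exact h
      · exact hmin ⟨ht, h.trans hc.2⟩ h
    rw [hepoch, hleast]
    obtain ⟨-, -, -, hlt⟩ := hc.1
    exact ⟨hlt, hsub hc⟩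
  have hmono : StrictMono (epoch S) := strictMono_nat_of_lt_succ fun n => (key n).1
  exact (infinite_of_injective_forall_mem (f := fun n => epoch S (n + 1))
    (fun a b h => Nat.succ_injective (hmono.injective h)) fun n => (key n).2)
    (hfin.image ENNReal.ofReal)

/-- The last epoch not after `s` starts a gap, since the next point lies beyond `s + 1`. -/
theorem firstGap_le {S : Set ℝ} (hS : S ⊆ Ioi 0) {s : ℝ} (hs : 0 ≤ s)
    (hfin : (S ∩ Ioc 0 (s + 1)).Finite) (h : S ∩ Ioc s (s + 1) = ∅) :
    firstGap 1 S ≤ ENNReal.ofReal s := by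
  classical
  have hex := exists_lt_epoch hs hS hfin
  obtain ⟨n, hn⟩ : ∃ n, Nat.find hex = n + 1 := by
    refine Nat.exists_eq_succ_of_ne_zero fun h0 => ?_
    have := Nat.find_spec hex
    rw [h0] at this
    exact absurd this (by simp [epoch])
  have h1 : epoch S n ≤ ENNReal.ofReal s := not_lt.1 (Nat.find_min hex (by omega))
  have h2 : ENNReal.ofReal s < epoch S (n + 1) := hn ▸ Nat.find_spec hex
  suffices h3 : epoch S n + ENNReal.ofReal 1 ≤ epoch S (n + 1) from
    le_trans (sInf_le ⟨n, rfl, h3⟩) h1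
  refine le_sInf ?_
  rintro t ⟨y, hy, rfl, hlt⟩
  have hys : s < y := by
    have : ENNReal.ofReal s < ENNReal.ofReal y := h2.trans_le (sInf_le ⟨y, hy, rfl, hlt⟩)
    exact (ENNReal.ofReal_lt_ofReal_iff (hS hy)).1 this
  have hy1 : s + 1 < y := by
    by_contra! h'
    have : y ∈ S ∩ Ioc s (s + 1) := ⟨hy, hys, h'⟩
    rw [h] at this
    exact this
  calc epoch S n + ENNReal.ofReal 1 ≤ ENNReal.ofReal s + ENNReal.ofReal 1 := by gcongr
    _ = ENNReal.ofReal (s + 1) := (ENNReal.ofReal_add hs zero_le_one).symm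
    _ ≤ ENNReal.ofReal y := ENNReal.ofReal_le_ofReal hy1.le

theorem le_firstGap {S : Set ℝ} {T : ℝ}
    (h : ∀ x, 0 ≤ x → x < T → ∃ y ∈ S, x < y ∧ y < x + 1) :
    ENNReal.ofReal T ≤ firstGap 1 S := by
  refine le_sInf ?_
  rintro t ⟨n, rfl, hn⟩
  by_contra! hlt
  have hx : epoch S n ≠ ∞ := hlt.ne_top
  set x := (epoch S n).toReal with hxdef
  have hex : epoch S n = ENNReal.ofReal x := (ENNReal.ofReal_toReal hx).symm
  have hx0 : 0 ≤ x := ENNReal.toReal_nonneg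
  rw [hex] at hlt
  obtain ⟨y, hy, hxy, hyx⟩ := h x hx0 ((ENNReal.ofReal_lt_ofReal_iff_of_nonneg hx0).1 hlt)
  have h1 : epoch S (n + 1) ≤ ENNReal.ofReal y := by
    refine sInf_le ⟨y, hy, rfl, ?_⟩
    rw [hex]
    exact (ENNReal.ofReal_lt_ofReal_iff_of_nonneg hx0).2 hxy
  have h2 := hn.trans h1
  rw [hex, ← ENNReal.ofReal_add hx0 zero_le_one] at h2
  exact absurd h2 (not_le.2 ((ENNReal.ofReal_lt_ofReal_iff_of_nonneg (by linarith)).2 hyx))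

/-! ### Power bounds for survival from bounds on the hazard. -/

section survProb_bounds

variable {k : ℕ} {q : ℕ → ℝ}

theorem survProb_le_rpow (h0 : ∀ i, 0 ≤ q i) (h1 : ∀ i, q i ≤ 1) (hk : 0 < k) {b c : ℝ}
    (hb : 0 ≤ b) (hc : 0 < c) {M : ℕ}
    (hq : ∀ i < M, b / (c + i) ≤ (∏ l ∈ Finset.range k, q (i + l)) * (1 - q (i + k))) (n : ℕ) :
    ∀ i, i + n ≤ M → survProb k q (n + k) i 0 ≤ ((c + i) / (c + i + n)) ^ b := by
  induction n with
  | zero =>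
    intro i _
    have : 0 < c + i := by positivity
    simp only [zero_add, Nat.cast_zero, add_zero, div_self this.ne', Real.one_rpow]
    rw [survProb_self hk]
    exact sub_le_self _ (Finset.prod_nonneg fun l _ => h0 _)
  | succ n ih =>
    intro i hi
    set y := c + i with hy
    have hy0 : 0 < y := by positivity
    rw [show n + 1 + k = n + k + 1 by omega, survProb_recursion hk]
    have hI := ih (i + 1) (by omega)
    push_cast at hI
    rw [← add_assoc, ← hy] at hI
    have hstep := survProb_steps_le h0 h1 hk n k (i + 1)
    rw [show i + 1 + k = i + k + 1 by omega] at hstep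
    have hV := survProb_nonneg (k := k) h0 h1 (n + k) (i + 1) 0
    have hqi := hq i (by omega)
    -- This factor makes the powers telescope from `c + i` to `c + i + n`.
    have hexp : 1 - b / y ≤ (y / (y + 1)) ^ b := by
      calc 1 - b / y ≤ Real.exp (-(b / y)) := by linarith [Real.add_one_le_exp (-(b / y))]
        _ = (Real.exp (-(1 / y))) ^ b := by rw [← Real.exp_mul]; congr 1; ring
        _ ≤ (y / (y + 1)) ^ b := by
          refine Real.rpow_le_rpow (Real.exp_pos _).le ?_ hb
          rw [Real.exp_neg, inv_le_comm₀ (Real.exp_pos _) (by positivity)]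
          have := Real.add_one_le_exp (1 / y)
          refine le_trans (le_of_eq ?_) this
          field_simp
          ring
    calc _ ≤ survProb k q (n + k) (i + 1) 0 - b / y * survProb k q (n + k) (i + 1) 0 := by
          have := mul_le_mul hqi hstep hV ((by positivity : 0 ≤ b / y).trans hqi)
          linarith
      _ = (1 - b / y) * survProb k q (n + k) (i + 1) 0 := by ring
      _ ≤ (y / (y + 1)) ^ b * ((y + 1) / (y + 1 + n)) ^ b := by
          gcongr
      _ = _ := by
          rw [← Real.mul_rpow (by positivity) (by positivity)]
          congr 1
          push_cast
          field_simp
          ring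

/-- Prefixing `k` more indices costs little: each adds a hazard of at most `b / c`, and `k * b / c ≤
η`. The survival probability inside each loss term is controlled by strong induction. -/
theorem survProb_le_mul_survProb (h0 : ∀ i, 0 ≤ q i) (h1 : ∀ i, q i ≤ 1) (hk : 0 < k)
    {b c ε η : ℝ} (hb : 0 ≤ b) (hc : 0 < c) (hε : 0 ≤ ε) (hη : 0 ≤ η) {M : ℕ}
    (hQ : ∀ i, i + k ≤ M → ∏ l ∈ Finset.range k, q (i + l) ≤ η)
    (hq : ∀ i, i + k + 1 ≤ M →
      (∏ l ∈ Finset.range k, q (i + l)) * (1 - q (i + k)) ≤ b / (c + i))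
    (hkb : k * b / c ≤ η) (hηε : 1 ≤ (1 + ε) * (1 - (2 + ε) * η)) (n : ℕ) :
    ∀ i, i + n + k ≤ M → survProb k q n (i + k) 0 ≤ (1 + ε) * survProb k q (n + k) i 0 := by
  induction n using Nat.strong_induction_on with
  | _ n ih =>
  intro i hi
  set X := survProb k q n (i + k) 0 with hX
  have hX0 : 0 ≤ X := survProb_nonneg h0 h1 _ _ _
  -- Interpolation from `V (n+k) i` at `l = 0` to `X` at `l = k`. For `l < n` the recursion gives
  -- the increment; at `l = n` exactly `k` indices are left before the step, costing at most `η`;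
  -- for `l > n` both terms equal `1`.
  set x : ℕ → ℝ := fun l => survProb k q (n + k - l) (i + l) 0 with hx
  have hd : ∀ l ∈ Finset.range k,
      x (l + 1) - x l ≤ (1 + ε) * (b / c) * X + (if l = n then η else 0) := by
    intro l hl
    rw [Finset.mem_range] at hl
    simp only [hx]
    rcases lt_trichotomy l n with h | h | h
    · obtain ⟨n', rfl⟩ : ∃ n', n = n' + 1 + l := ⟨n - l - 1, by omega⟩
      rw [show n' + 1 + l + k - (l + 1) = n' + k by omega,
        show n' + 1 + l + k - l = n' + k + 1 by omega, survProb_recursion hk, if_neg (by omega)]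
      have hI := ih n' (by omega) (i + l + 1) (by omega)
      have hs := survProb_steps_le h0 h1 hk (n' + 1 + l) (k - l - 1) (i + l + 1)
      rw [show n' + 1 + l + (k - l - 1) = n' + k by omega,
        show i + l + 1 + (k - l - 1) = i + k by omega] at hs
      have hqi := hq (i + l) (by omega)
      have hbc : b / (c + (i + l : ℕ)) ≤ b / c := by
        have : (0 : ℝ) ≤ (i + l : ℕ) := Nat.cast_nonneg _
        gcongr
        linarith
      rw [show i + l + 1 + k = i + l + k + 1 by omega] at hI
      have hP : 0 ≤ survProb k q n' (i + l + k + 1) 0 := survProb_nonneg h0 h1 _ _ _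
      have e1 : (∏ j ∈ Finset.range k, q (i + l + j)) * (1 - q (i + l + k)) *
          survProb k q n' (i + l + k + 1) 0 ≤ b / c * ((1 + ε) * X) := by
        refine mul_le_mul (hqi.trans hbc) (hI.trans ?_) hP (by positivity)
        exact mul_le_mul_of_nonneg_left hs (by linarith)
      rw [← add_assoc i l 1]
      linarith
    · subst h
      rw [if_pos rfl, show l + k - (l + 1) = k - 1 by omega, show l + k - l = k by omega,
        survProb_self hk, survProb_eq_one _ _ _ (by omega)]
      have := hQ (i + l) (by omega)
      have : 0 ≤ (1 + ε) * (b / c) * X := by positivity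
      linarith
    · rw [survProb_eq_one _ _ _ (by omega), survProb_eq_one _ _ _ (by omega), if_neg (by omega)]
      have : 0 ≤ (1 + ε) * (b / c) * X := by positivity
      linarith
  have hsum := Finset.sum_le_sum hd
  rw [Finset.sum_range_sub, Finset.sum_add_distrib, Finset.sum_const, Finset.card_range,
    Finset.sum_ite_eq', nsmul_eq_mul] at hsum
  have hxk : x k = X := by simp [hx, hX]
  have hx0 : x 0 = survProb k q (n + k) i 0 := by simp [hx]
  rw [hxk, hx0] at hsum
  -- The exceptional increment occurs only if `n < k`, and then `X = 1`.
  have h3 : (if n ∈ Finset.range k then η else 0) ≤ η * X := by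
    split_ifs with h
    · rw [hX, survProb_eq_one _ _ _ (by simpa using h), mul_one]
    · positivity
  have h4 : k * ((1 + ε) * (b / c) * X) ≤ (1 + ε) * η * X := by
    calc k * ((1 + ε) * (b / c) * X) = (1 + ε) * (k * b / c) * X := by ring
      _ ≤ _ := by gcongr
  have h5 : (1 - (2 + ε) * η) * X ≤ survProb k q (n + k) i 0 := by linarith
  calc X = 1 * X := (one_mul X).symm
    _ ≤ (1 + ε) * (1 - (2 + ε) * η) * X := by gcongr
    _ = (1 + ε) * ((1 - (2 + ε) * η) * X) := by ring
    _ ≤ _ := by gcongr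

theorem rpow_le_survProb (h0 : ∀ i, 0 ≤ q i) (h1 : ∀ i, q i ≤ 1) (hk : 0 < k)
    {b b' c ε η : ℝ} (hb : 0 ≤ b) (hb' : 0 ≤ b') (hc : 1 < c) (hε : 0 ≤ ε) (hη : 0 ≤ η) {M : ℕ}
    (hQ : ∀ i, i + k ≤ M → ∏ l ∈ Finset.range k, q (i + l) ≤ η)
    (hq : ∀ i, i + k + 1 ≤ M →
      (∏ l ∈ Finset.range k, q (i + l)) * (1 - q (i + k)) ≤ b / (c + i))
    (hkb : k * b / c ≤ η) (hηε : 1 ≤ (1 + ε) * (1 - (2 + ε) * η))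
    (hη1 : η ≤ 1) (hbb : (1 + ε) * b ≤ b' * (1 - (1 + ε) * b / c)) (n : ℕ) :
    ∀ i, i + n + k ≤ M →
      (1 - η) * ((c - 1 + i) / (c - 1 + i + n)) ^ b' ≤ survProb k q (n + k) i 0 := by
  induction n with
  | zero =>
    intro i hi
    have : 0 < c - 1 + i := by have : (0 : ℝ) ≤ i := by positivity
                               linarith
    simp only [zero_add, Nat.cast_zero, add_zero, div_self this.ne', Real.one_rpow, mul_one]
    rw [survProb_self hk]
    linarith [hQ i (by omega)]
  | succ n ih =>
    intro i hi
    set y := c + i with hy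
    have hi0 : (0 : ℝ) ≤ i := by positivity
    have hy1 : 1 < y := by linarith
    have hI := ih (i + 1) (by omega)
    push_cast at hI
    rw [show c - 1 + ((i : ℝ) + 1) = y by rw [hy]; ring] at hI
    have hR := survProb_le_mul_survProb h0 h1 hk hb (by linarith : 0 < c) hε hη hQ hq hkb hηε n
      (i + 1) (by omega)
    rw [show i + 1 + k = i + k + 1 by omega] at hR
    have hqi := hq i (by omega)
    rw [show n + 1 + k = n + k + 1 by omega, survProb_recursion hk]
    have hV := survProb_nonneg (k := k) h0 h1 (n + k) (i + 1) 0
    have hW := survProb_nonneg (k := k) h0 h1 n (i + k + 1) 0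
    -- The gap between `b` and `b'` absorbs both `1 + ε` and the second-order error of the
    -- exponential; the base `y - 1` allows `1 - 1 / y ≤ exp (-(1 / y))`.
    have hexp : ((y - 1) / y) ^ b' ≤ 1 - (1 + ε) * b / y := by
      have hz : 0 ≤ b' / y := by positivity
      have e1 : ((y - 1) / y) ^ b' ≤ Real.exp (-(b' / y)) := by
        calc ((y - 1) / y) ^ b' ≤ (Real.exp (-(1 / y))) ^ b' := by
              refine Real.rpow_le_rpow (div_nonneg (by linarith) (by linarith)) ?_ hb'
              rw [sub_div, div_self (by linarith)]
              linarith [Real.add_one_le_exp (-(1 / y))]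
          _ = _ := by rw [← Real.exp_mul]; congr 1; ring
      have e2 : Real.exp (-(b' / y)) ≤ (1 + b' / y)⁻¹ := by
        rw [Real.exp_neg]
        gcongr
        linarith [Real.add_one_le_exp (b' / y)]
      refine e1.trans (e2.trans ?_)
      rw [inv_le_iff_one_le_mul₀ (by positivity)]
      have e3 : (1 + ε) * b / y ≤ (1 + ε) * b / c := by gcongr; linarith
      have e4 : (1 + ε) * b ≤ b' * (1 - (1 + ε) * b / y) := hbb.trans (by gcongr)
      have e5 : (1 + ε) * b / y ≤ b' / y * (1 - (1 + ε) * b / y) := by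
        calc (1 + ε) * b / y ≤ b' * (1 - (1 + ε) * b / y) / y := by gcongr
          _ = _ := by ring
      linarith
    have hA : 0 ≤ ((y - 1) / y) ^ b' :=
      Real.rpow_nonneg (div_nonneg (by linarith) (by linarith)) _
    calc (1 - η) * ((c - 1 + i) / (c - 1 + i + (n + 1 : ℕ))) ^ b'
        = ((y - 1) / y) ^ b' * ((1 - η) * (y / (y + n)) ^ b') := by
          rw [mul_left_comm, ← Real.mul_rpow (div_nonneg (by linarith) (by linarith))
            (by positivity)]
          congr 2
          rw [div_mul_div_cancel₀ (by linarith), hy]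
          push_cast
          congr 1 <;> ring
      _ ≤ (1 - (1 + ε) * b / y) * survProb k q (n + k) (i + 1) 0 :=
          mul_le_mul hexp hI (mul_nonneg (by linarith) (by positivity)) (hA.trans hexp)
      _ = survProb k q (n + k) (i + 1) 0 -
          b / y * ((1 + ε) * survProb k q (n + k) (i + 1) 0) := by ring
      _ ≤ _ := by
          have := mul_le_mul hqi hR hW (by positivity)
          linarith

end survProb_bounds

/-! ### Intensity of intervals. -/

section intensity

variable {μ : ℝ → ℝ} {u v : ℝ}

theorem intensity_Ioc (hu : 0 ≤ u) :
    intensity μ (Ioc u v) = ∫⁻ x in Ioc u v, ENNReal.ofReal (μ x) := by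
  rw [intensity, withDensity_apply _ measurableSet_Ioc, Measure.restrict_restrict measurableSet_Ioc,
    inter_eq_left.2 fun x hx => mem_Ioi.2 (hu.trans_lt hx.1)]

theorem IsRateFunction.intensity_Ioc_ne_top (hμ : IsRateFunction μ) (hu : 0 ≤ u) :
    intensity μ (Ioc u v) ≠ ∞ := by
  rw [intensity_Ioc hu]
  exact ((hμ.integrableOn v).mono_set (Ioc_subset_Ioc_left hu)).lintegral_lt_top.ne

theorem IsRateFunction.toReal_intensity_Ioc_pos (hμ : IsRateFunction μ) (hu : 0 ≤ u)
    (huv : u < v) : 0 < (intensity μ (Ioc u v)).toReal := by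
  refine ENNReal.toReal_pos (fun h0 => ?_) (hμ.intensity_Ioc_ne_top hu)
  rw [intensity_Ioc hu] at h0
  have hint := (hμ.integrableOn v).mono_set (Ioc_subset_Ioc_left hu)
  rw [lintegral_eq_zero_iff' hint.aemeasurable.ennreal_ofReal] at h0
  have hpos : ∀ᵐ x ∂(volume.restrict (Ioc u v)), 0 < μ x :=
    ae_mono (Measure.restrict_mono (fun x hx => mem_Ioi.2 (hu.trans_lt hx.1)) le_rfl) hμ.pos
  have hfalse : ∀ᵐ x ∂(volume.restrict (Ioc u v)), False := by
    filter_upwards [h0, hpos] with x h1 h2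
    exact absurd (ENNReal.ofReal_eq_zero.1 h1) (not_le.2 h2)
  have := ae_iff.1 hfalse
  simp at this
  linarith

theorem toReal_intensity_Ioc_le (hu : 0 ≤ u) (huv : u ≤ v) {C : ℝ} (hC : 0 ≤ C)
    (h : ∀ x ∈ Ioc u v, μ x ≤ C) : (intensity μ (Ioc u v)).toReal ≤ C * (v - u) := by
  refine ENNReal.toReal_le_of_le_ofReal (mul_nonneg hC (by linarith)) ?_
  rw [intensity_Ioc hu, ENNReal.ofReal_mul hC]
  calc ∫⁻ x in Ioc u v, ENNReal.ofReal (μ x) ≤ ∫⁻ x in Ioc u v, ENNReal.ofReal C :=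
        setLIntegral_mono' measurableSet_Ioc fun x hx => ENNReal.ofReal_le_ofReal (h x hx)
    _ = _ := by rw [setLIntegral_const, Real.volume_Ioc]

theorem IsRateFunction.le_toReal_intensity_Ioc (hμ : IsRateFunction μ) (hu : 0 ≤ u)
    {C : ℝ} (hC : 0 ≤ C) (h : ∀ x ∈ Ioc u v, C ≤ μ x) :
    C * (v - u) ≤ (intensity μ (Ioc u v)).toReal := by
  rw [← ENNReal.ofReal_le_iff_le_toReal (hμ.intensity_Ioc_ne_top hu), intensity_Ioc hu,
    ENNReal.ofReal_mul hC]
  calc _ = ∫⁻ x in Ioc u v, ENNReal.ofReal C := by rw [setLIntegral_const, Real.volume_Ioc]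
    _ ≤ _ := setLIntegral_mono' measurableSet_Ioc fun x hx => ENNReal.ofReal_le_ofReal (h x hx)

end intensity

/-! ### Asymptotics of the critical rate. -/

/-- The critical rate function `log t + log log t - log a`. -/
noncomputable def critRate (a t : ℝ) : ℝ := Real.log t + Real.log (Real.log t) - Real.log a

section critRate

variable {a : ℝ}

theorem critRate_mono {s t : ℝ} (hs : 1 < s) (hst : s ≤ t) : critRate a s ≤ critRate a t := by
  unfold critRate
  have := Real.log_pos hs
  gcongr

theorem exp_neg_critRate (ha : 0 < a) {t : ℝ} (ht : 1 < t) :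
    Real.exp (-critRate a t) = a / (t * Real.log t) := by
  have := Real.log_pos ht
  rw [critRate, neg_sub, Real.exp_sub, Real.exp_add, Real.exp_log ha, Real.exp_log (by linarith),
    Real.exp_log this]

theorem eventually_log_le_critRate (ha : 0 < a) : ∀ᶠ t in atTop, Real.log t ≤ critRate a t := by
  filter_upwards [Real.tendsto_log_atTop.eventually_ge_atTop a] with t ht
  have := Real.log_le_log ha ht
  unfold critRate
  linarith

theorem eventually_critRate_add_one_le (a : ℝ) {δ : ℝ} (hδ : 0 < δ) :
    ∀ᶠ t in atTop, critRate a (t + 1) ≤ (1 + δ) * Real.log t := by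
  have h1 : ∀ᶠ u in atTop, Real.log u ≤ δ / 2 * u := by
    filter_upwards [Real.isLittleO_log_id_atTop.bound (half_pos hδ), eventually_ge_atTop 0]
      with u hu hu0
    rw [Real.norm_eq_abs, Real.norm_eq_abs, id, abs_of_nonneg hu0] at hu
    exact (le_abs_self _).trans hu
  have h2 : Tendsto (fun t : ℝ => Real.log (t + 1)) atTop atTop :=
    Real.tendsto_log_atTop.comp (tendsto_atTop_add_const_right _ _ tendsto_id)
  filter_upwards [h2.eventually h1, eventually_ge_atTop 1,
    (Real.tendsto_log_atTop.const_mul_atTop (half_pos hδ)).eventually_ge_atTop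
      ((1 + δ / 2) * Real.log 2 - Real.log a)] with t h3 h4 h5
  have h6 : Real.log (t + 1) ≤ Real.log t + Real.log 2 := by
    rw [← Real.log_mul (by linarith) two_ne_zero]
    exact Real.log_le_log (by linarith) (by linarith)
  have h7 := mul_le_mul_of_nonneg_left h6 (by linarith : 0 ≤ 1 + δ / 2)
  unfold critRate
  linarith

theorem div_one_add_le_one_sub_exp_neg {x : ℝ} (hx : 0 ≤ x) : x / (1 + x) ≤ 1 - Real.exp (-x) := by
  have h : Real.exp (-x) ≤ (1 + x)⁻¹ := by
    rw [Real.exp_neg]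
    gcongr
    linarith [Real.add_one_le_exp x]
  have : x / (1 + x) = 1 - (1 + x)⁻¹ := by field_simp; ring
  linarith

/-- Lower bound for the probability that a gap of length one starts in a given cell. -/
theorem eventually_le_exp_mul (ha : 0 < a) {b δ : ℝ} (hb : 0 < b) (hδ : 0 < δ)
    (hbδ : b * (1 + δ) ^ 2 ≤ a) : ∀ᶠ t in atTop, ∀ m : ℝ, 0 < m → critRate a (t + 1) / m ≤ δ →
      b / (m * t) ≤ Real.exp (-critRate a (t + 1)) * (1 - Real.exp (-(critRate a (t + 1) / m))) := by
  have h1 : Tendsto (fun t : ℝ => t + 1) atTop atTop :=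
    tendsto_atTop_add_const_right _ _ tendsto_id
  filter_upwards [h1.eventually (eventually_log_le_critRate ha), eventually_gt_atTop 0,
    eventually_ge_atTop (1 / δ)] with t ht ht0 htδ m hm hx
  have hl : 0 < Real.log (t + 1) := Real.log_pos (by linarith)
  set L := critRate a (t + 1) with hL
  have hL0 : 0 < L := hl.trans_le ht
  have hx0 : 0 < L / m := by positivity
  rw [hL, exp_neg_critRate ha (by linarith), ← hL]
  refine le_trans ?_ (mul_le_mul_of_nonneg_left (div_one_add_le_one_sub_exp_neg hx0.le)
    (by positivity))
  -- One factor `1 + δ` pays for replacing `t + 1` by `t`, the other for the denominator `1 + L /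
  -- m`.
  have h2 : t + 1 ≤ (1 + δ) * t := by
    rw [div_le_iff₀ hδ] at htδ
    linarith
  calc b / (m * t) = b * (1 + δ) ^ 2 / (m * ((1 + δ) * t) * (1 + δ)) := by field_simp
    _ ≤ a / (m * (t + 1) * (1 + L / m)) := by gcongr
    _ = a / ((t + 1) * Real.log (t + 1)) * (Real.log (t + 1) / m / (1 + L / m)) := by
        field_simp
    _ ≤ _ := by gcongr

/-- Upper bound for the probability that a gap of length almost one starts in a given cell. -/
theorem eventually_exp_mul_le (ha : 0 < a) {b δ : ℝ} (hδ : 0 < δ)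
    (hbδ : a * Real.exp (2 * δ) * (1 + δ) ≤ b) :
    ∀ᶠ t in atTop, ∀ m : ℝ, 0 < m → critRate a t / m ≤ δ →
      Real.exp (-((m - 2) / m * critRate a t)) * (critRate a (t + 1) / m) ≤ b / (m * t) := by
  have hs : Tendsto (fun t : ℝ => t + 1) atTop atTop :=
    tendsto_atTop_add_const_right _ _ tendsto_id
  filter_upwards [eventually_critRate_add_one_le a hδ, eventually_gt_atTop 1,
    hs.eventually (eventually_log_le_critRate ha)] with t h1 h2 h3 m hm hx
  have hl := Real.log_pos h2
  have h4 : 0 ≤ critRate a (t + 1) := (Real.log_pos (by linarith)).le.trans h3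
  -- The two missing cells cost at most a factor `exp (2 * δ)`.
  have e : -((m - 2) / m * critRate a t) = -critRate a t + 2 * (critRate a t / m) := by
    field_simp; ring
  rw [e, Real.exp_add, exp_neg_critRate ha h2]
  have ht : 0 < t := by linarith
  calc _ ≤ a / (t * Real.log t) * Real.exp (2 * δ) * ((1 + δ) * Real.log t / m) := by gcongr
    _ = a * Real.exp (2 * δ) * (1 + δ) / (m * t) := by field_simp
    _ ≤ _ := by gcongr

/-- The probability that an interval of length almost one is empty tends to zero. -/
theorem eventually_exp_le (ha : 0 < a) {δ η : ℝ} (hη : 0 < η) :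
    ∀ᶠ t in atTop, ∀ m : ℝ, 0 < m → critRate a t / m ≤ δ →
      Real.exp (-((m - 2) / m * critRate a t)) ≤ η := by
  have h : Tendsto (fun t : ℝ => a * Real.exp (2 * δ) * (t * Real.log t)⁻¹) atTop (nhds 0) := by
    have := (tendsto_id.atTop_mul_atTop₀ Real.tendsto_log_atTop).inv_tendsto_atTop.const_mul
      (a * Real.exp (2 * δ))
    simpa using this
  filter_upwards [h.eventually_le_const hη, eventually_gt_atTop 1] with t h1 h2 m hm hx
  have hl := Real.log_pos h2
  have e : -((m - 2) / m * critRate a t) = -critRate a t + 2 * (critRate a t / m) := by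
    field_simp; ring
  rw [e, Real.exp_add, exp_neg_critRate ha h2]
  refine le_trans ?_ h1
  have ht : 0 < t := by linarith
  calc _ ≤ a / (t * Real.log t) * Real.exp (2 * δ) := by gcongr
    _ = _ := by field_simp

end critRate

/-! ### Upper tail bound and finite moments. -/

theorem inter_Ioc_eq_empty {S : Set ℝ} {s : ℕ → ℝ} {l : ℕ} (n : ℕ)
    (h : ∀ j, l ≤ j → j < l + n → S ∩ Ioc (s j) (s (j + 1)) = ∅) :
    S ∩ Ioc (s l) (s (l + n)) = ∅ := by
  induction n with
  | zero => simp
  | succ n ih =>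
    have h1 := ih fun j hj hj' => h j hj (by omega)
    have h2 := h (l + n) (by omega) (by omega)
    rw [eq_empty_iff_forall_notMem] at h1 h2 ⊢
    rintro y ⟨hy, hly, hyl⟩
    rcases le_or_gt y (s (l + n)) with h3 | h3
    · exact h1 y ⟨hy, hly, h3⟩
    · exact h2 y ⟨hy, h3, hyl⟩

section upper

variable {Ω : Type*} [MeasurableSpace Ω] {P : Measure Ω} [IsProbabilityMeasure P] {μ : ℝ → ℝ}
  {N : Ω → Set ℝ} {a : ℝ}

/-- The rate is taken at the right end of each cell, where it is largest. The same sequence serves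
the lower bound as left-end values, the first fine cell being set aside there. -/
theorem exists_survProb_le (ha : 0 < a) {b : ℝ} (hb : 0 < b) (hba : b < a) :
    ∀ᶠ t₀ : ℝ in atTop, ∀ L : ℕ, ∃ m : ℕ, 0 < m ∧
      survProb m (fun i => Real.exp (-(critRate a (t₀ + (i + 1 : ℕ) / m) / m))) (m * L + m) 0 0 ≤
        (t₀ / (t₀ + L)) ^ b := by
  obtain ⟨δ, hbδ, hδ⟩ : ∃ δ : ℝ, b * (1 + δ) ^ 2 ≤ a ∧ 0 < δ := by
    have hc : Tendsto (fun δ : ℝ => b * (1 + δ) ^ 2) (nhdsWithin 0 (Ioi 0)) (nhds b) := by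
      have : Continuous (fun δ : ℝ => b * (1 + δ) ^ 2) := by fun_prop
      have := (this.tendsto 0).mono_left (nhdsWithin_le_nhds (s := Ioi 0))
      simpa using this
    exact ((hc.eventually_le_const hba).and self_mem_nhdsWithin).exists
  obtain ⟨t₁, ht₁⟩ := eventually_atTop.1
    ((eventually_le_exp_mul ha hb hδ hbδ).and (eventually_log_le_critRate ha))
  filter_upwards [eventually_ge_atTop t₁, eventually_gt_atTop 1] with t₀ h₀ h1 L
  set R := critRate a (t₀ + L + 2) with hR
  -- The mesh depends on the horizon: it is fine enough that each cell has mass at most `δ`,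
  -- although the rate is unbounded.
  set m : ℕ := ⌈R / δ⌉₊ + 1 with hm
  have hm0 : 0 < (m : ℝ) := by positivity
  have hRm : R / m ≤ δ := by
    rw [div_le_iff₀ hm0, ← div_le_iff₀' hδ, hm]
    push_cast
    linarith [Nat.le_ceil (R / δ)]
  have hcrit0 : ∀ t, t₀ ≤ t → 0 ≤ critRate a t := fun t ht =>
    (Real.log_pos (h1.trans_le ht)).le.trans (ht₁ t (h₀.trans ht)).2
  set q : ℕ → ℝ := fun i => Real.exp (-(critRate a (t₀ + (i + 1 : ℕ) / m) / m)) with hq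
  have hq0 : ∀ i, 0 ≤ q i := fun i => (Real.exp_pos _).le
  have hq1 : ∀ i, q i ≤ 1 := fun i => Real.exp_le_one_iff.2
    (neg_nonpos.2 (div_nonneg (hcrit0 _ (le_add_of_nonneg_right (by positivity))) hm0.le))
  refine ⟨m, by omega, ?_⟩
  have key := survProb_le_rpow hq0 hq1 (by omega : 0 < m) hb.le (by positivity : 0 < m * t₀)
    (M := m * L) ?_ (m * L) 0 (by omega)
  · refine key.trans_eq ?_
    congr 1
    push_cast
    rw [add_zero, ← mul_add, mul_div_mul_left _ _ hm0.ne']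
  · intro i hi
    set t := t₀ + i / m with ht
    have hiL : (i : ℝ) / m ≤ L := by
      rw [div_le_iff₀' hm0]
      exact_mod_cast hi.le
    have htt : t₀ ≤ t := le_add_of_nonneg_right (by positivity)
    have hx : critRate a (t + 1) / m ≤ δ := by
      refine le_trans ?_ hRm
      gcongr
      exact critRate_mono (by linarith) (by linarith)
    have hmain := (ht₁ t (h₀.trans htt)).1 m hm0 hx
    rw [show (m : ℝ) * t = m * t₀ + i by rw [ht]; field_simp] at hmain
    refine hmain.trans ?_
    have e1 : Real.exp (-critRate a (t + 1)) ≤ ∏ l ∈ Finset.range m, q (i + l) := by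
      calc Real.exp (-critRate a (t + 1))
          = ∏ l ∈ Finset.range m, Real.exp (-(critRate a (t + 1) / m)) := by
            rw [Finset.prod_const, Finset.card_range, ← Real.exp_nat_mul]
            congr 1
            field_simp
        _ ≤ _ := by
            refine Finset.prod_le_prod (fun _ _ => (Real.exp_pos _).le) fun l hl => ?_
            have hl' : ((l : ℝ) + 1) / m ≤ 1 := by
              rw [div_le_one hm0]
              exact_mod_cast Finset.mem_range.1 hl
            simp only [hq]
            gcongr
            refine critRate_mono (h1.trans_le (le_add_of_nonneg_right (by positivity))) ?_
            rw [ht]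
            push_cast
            have : ((i : ℝ) + l + 1) / m = i / m + (l + 1) / m := by ring
            linarith
    have e2 : q (i + m) ≤ Real.exp (-(critRate a (t + 1) / m)) := by
      simp only [hq]
      gcongr
      refine critRate_mono (by linarith) ?_
      rw [ht]
      push_cast
      have : ((i : ℝ) + m + 1) / m = i / m + 1 + 1 / m := by field_simp
      have : 0 < 1 / (m : ℝ) := by positivity
      linarith
    have hx0 : 0 ≤ critRate a (t + 1) / m := div_nonneg (hcrit0 _ (by linarith)) hm0.le
    refine mul_le_mul e1 (by linarith) ?_ ((Real.exp_pos _).le.trans e1)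
    rw [sub_nonneg, Real.exp_le_one_iff]
    linarith

theorem IsPoissonProcess.exists_tail_le (hN : IsPoissonProcess P μ N) (hμ : IsRateFunction μ)
    (ha : 0 < a) (h : ∀ᶠ t in atTop, μ t ≤ critRate a t) {b : ℝ} (hb : 0 < b) (hba : b < a) :
    ∃ t₀ : ℕ, 0 < t₀ ∧ ∀ L : ℕ, ∃ F : Set Ω, MeasurableSet F ∧
      (∀ᵐ ω ∂P, ω ∉ F → firstGap 1 (N ω) ≤ ENNReal.ofReal (t₀ + L)) ∧
      P.real F ≤ ((t₀ : ℝ) / (t₀ + L)) ^ b := by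
  obtain ⟨t₁, ht₁⟩ := eventually_atTop.1 ((exists_survProb_le ha hb hba).and
    (h.and (eventually_log_le_critRate ha)))
  refine ⟨⌈t₁⌉₊ + 2, by omega, fun L => ?_⟩
  set t₀ : ℕ := ⌈t₁⌉₊ + 2 with ht₀
  have h₀ : t₁ ≤ t₀ := by
    rw [ht₀]
    push_cast
    linarith [Nat.le_ceil t₁]
  have h1 : (1 : ℝ) < t₀ := by exact_mod_cast (by omega : 1 < t₀)
  obtain ⟨m, hm, hS⟩ := (ht₁ t₀ h₀).1 L
  have hm0 : 0 < (m : ℝ) := by positivity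
  set s : ℕ → ℝ := fun i => t₀ + i / m with hs
  have hsm : Monotone s := fun i j hij => by simp only [hs]; gcongr
  have hs0 : ∀ i, (t₀ : ℝ) ≤ s i := fun i => le_add_of_nonneg_right (by positivity)
  have hs0' : ∀ i, 0 ≤ s i := fun i => by linarith [hs0 i]
  set E : ℕ → Set Ω := fun i => {ω | N ω ∩ Ioc (s i) (s (i + 1)) = ∅} with hE
  have hEm : ∀ i, MeasurableSet (E i) := fun i => hN.measurableSet_void measurableSet_Ioc
  have hcrit0 : ∀ i, 0 ≤ critRate a (s i) := fun i =>
    (Real.log_pos (h1.trans_le (hs0 i))).le.trans (ht₁ _ (h₀.trans (hs0 i))).2.2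
  -- With `m * L + m` cells, a run of `m` starts at an index at most `m * L`, hence no later than
  -- `t₀ + L`.
  refine ⟨{ω | Surv m (fun j => ω ∈ E j) (m * L + m) 0 0},
    measurableSet_surv _ _ _ _ _ fun j _ _ => hEm j, ?_, ?_⟩
  · have hfin := hN.ae_finite (measurableSet_Ioc (a := 0) (b := (t₀ : ℝ) + L + 1))
      (hμ.intensity_Ioc_ne_top le_rfl)
    filter_upwards [hfin] with ω hω hF
    obtain ⟨l, hl, hrun⟩ := exists_run_of_not_surv (Nat.zero_le m) le_rfl
      (fun j _ hj => absurd hj (Nat.not_lt_zero j)) hF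
    have hempty : N ω ∩ Ioc (s l) (s (l + m)) = ∅ := inter_Ioc_eq_empty m hrun
    have hslm : s (l + m) = s l + 1 := by
      simp only [hs]
      push_cast
      field_simp
      ring
    have hsl : s l ≤ t₀ + L := by
      simp only [hs]
      gcongr
      rw [div_le_iff₀' hm0]
      exact_mod_cast (by omega : l ≤ m * L)
    rw [hslm] at hempty
    refine (firstGap_le (hN.subset ω) (hs0' l) (hω.subset ?_) hempty).trans
      (ENNReal.ofReal_le_ofReal hsl)
    gcongr
  · rw [measureReal_surv hEm (hN.iIndepSet_void hsm)
      (fun j => hN.measureReal_void measurableSet_Ioc (hμ.intensity_Ioc_ne_top (hs0' j)))]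
    refine le_trans (survProb_anti (fun i => (Real.exp_pos _).le) (fun i => ?_)
      (fun i => (Real.exp_pos _).le) (fun i => ?_) (m * L + m) (fun i _ => ?_) _ _ _ (by omega)) hS
    · exact Real.exp_le_one_iff.2 (neg_nonpos.2 (div_nonneg (hcrit0 (i + 1)) hm0.le))
    · exact Real.exp_le_one_iff.2 (neg_nonpos.2 ENNReal.toReal_nonneg)
    · gcongr
      refine (toReal_intensity_Ioc_le (hs0' i) (hsm (Nat.le_succ i)) (hcrit0 (i + 1))
        fun x hx => ?_).trans_eq ?_
      · have hx0 : (t₀ : ℝ) < x := (hs0 i).trans_lt hx.1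
        exact (ht₁ x (h₀.trans hx0.le)).2.1.trans (critRate_mono (h1.trans hx0) hx.2)
      · simp only [hs]
        push_cast
        field_simp
        ring

theorem IsPoissonProcess.gapMoment_lt_top (hN : IsPoissonProcess P μ N) (hμ : IsRateFunction μ)
    (ha : 0 < a) (h : ∀ᶠ t in atTop, μ t ≤ critRate a t) {p : ℝ} (hp : 0 ≤ p) (hpa : p < a) :
    gapMoment P 1 N p < ∞ := by
  obtain ⟨b, hpb, hba⟩ := exists_between hpa
  have hb : 0 < b := hp.trans_lt hpb
  obtain ⟨t₀, ht₀, htail⟩ := hN.exists_tail_le hμ ha h hb hba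
  have hdyadic : ∀ j : ℕ, ∃ F : Set Ω, MeasurableSet F ∧
      (∀ᵐ ω ∂P, ω ∉ F → firstGap 1 (N ω) ≤ ENNReal.ofReal (2 ^ j)) ∧
      P F ≤ ENNReal.ofReal (((t₀ : ℝ) / 2 ^ j) ^ b) := by
    intro j
    rcases le_total t₀ (2 ^ j) with hj | hj
    · obtain ⟨F, hF, hF1, hF2⟩ := htail (2 ^ j - t₀)
      have e : (t₀ : ℝ) + (2 ^ j - t₀ : ℕ) = 2 ^ j := by
        rw [Nat.cast_sub hj]
        push_cast
        ring
      rw [e] at hF1 hF2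
      refine ⟨F, hF, hF1, ?_⟩
      rw [← ofReal_measureReal]
      exact ENNReal.ofReal_le_ofReal hF2
    · refine ⟨univ, MeasurableSet.univ, by simp, ?_⟩
      rw [measure_univ, ENNReal.one_le_ofReal]
      refine Real.one_le_rpow ?_ hb.le
      rw [one_le_div (by positivity)]
      exact_mod_cast hj
  choose F hFm hFD hFP using hdyadic
  set w : ℕ → ℝ := fun j => ((2 : ℝ) ^ (j + 1)) ^ p with hw
  have hw0 : ∀ j, 0 ≤ w j := fun j => by positivity
  have hw1 : ∀ j, 1 ≤ w j := fun j => Real.one_le_rpow (one_le_pow₀ one_le_two) hp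
  -- If `j + 1` is the first index with `ω ∉ F (j + 1)`, then `ω ∈ F j` and `D ≤ 2 ^ (j + 1)`. If
  -- `ω` lies in every `F j`, the series diverges, so nothing need be known about `D`.
  have hbound : ∀ᵐ ω ∂P, firstGap 1 (N ω) ^ p ≤
      1 + ∑' j, (F j).indicator (fun _ => ENNReal.ofReal (w j)) ω := by
    filter_upwards [ae_all_iff.2 hFD] with ω hω
    classical
    by_cases hall : ∃ j, ω ∉ F j
    · have hD := hω _ (Nat.find_spec hall)
      rcases hj : Nat.find hall with _ | j
      · rw [hj, pow_zero, ENNReal.ofReal_one] at hD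
        exact (ENNReal.rpow_le_one hD hp).trans le_self_add
      · have hmem : ω ∈ F j := not_not.1 (Nat.find_min hall (by omega : j < Nat.find hall))
        rw [hj] at hD
        calc firstGap 1 (N ω) ^ p ≤ ENNReal.ofReal (2 ^ (j + 1)) ^ p := by gcongr
          _ = (F j).indicator (fun _ => ENNReal.ofReal (w j)) ω := by
            rw [indicator_of_mem hmem, ENNReal.ofReal_rpow_of_nonneg (by positivity) hp]
          _ ≤ ∑' j, (F j).indicator (fun _ => ENNReal.ofReal (w j)) ω := ENNReal.le_tsum j
          _ ≤ _ := le_add_self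
    · push Not at hall
      have : ∑' j, (F j).indicator (fun _ => ENNReal.ofReal (w j)) ω = ∞ := by
        rw [eq_top_iff, ← ENNReal.tsum_const_eq_top_of_ne_zero (α := ℕ) one_ne_zero]
        refine ENNReal.tsum_le_tsum fun j => ?_
        rw [indicator_of_mem (hall j), ENNReal.one_le_ofReal]
        exact hw1 j
      rw [this]
      simp
  -- The expected series is geometric with ratio `2 ^ (p - b) < 1`.
  have hr0 : 0 ≤ (2 : ℝ) ^ (p - b) := by positivity
  have hr1 : (2 : ℝ) ^ (p - b) < 1 := Real.rpow_lt_one_of_one_lt_of_neg one_lt_two (by linarith)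
  have hterm : ∀ j, w j * ((t₀ : ℝ) / 2 ^ j) ^ b =
      2 ^ p * (t₀ : ℝ) ^ b * ((2 : ℝ) ^ (p - b)) ^ j := by
    intro j
    simp only [hw]
    rw [Real.rpow_pow_comm zero_le_two, Real.rpow_sub (by positivity), pow_succ,
      Real.mul_rpow (by positivity) zero_le_two, Real.div_rpow (by positivity) (by positivity)]
    ring
  calc gapMoment P 1 N p
      ≤ ∫⁻ ω, (1 + ∑' j, (F j).indicator (fun _ => ENNReal.ofReal (w j)) ω) ∂P :=
        lintegral_mono_ae hbound
    _ = 1 + ∑' j, ENNReal.ofReal (w j) * P (F j) := by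
        rw [lintegral_add_left measurable_const, lintegral_const, measure_univ, mul_one,
          lintegral_tsum fun j => (measurable_const.indicator (hFm j)).aemeasurable]
        simp_rw [lintegral_indicator_const (hFm _)]
    _ ≤ 1 + ∑' j, ENNReal.ofReal (2 ^ p * (t₀ : ℝ) ^ b * ((2 : ℝ) ^ (p - b)) ^ j) := by
        gcongr with j
        rw [← hterm, ENNReal.ofReal_mul (hw0 j)]
        gcongr
        exact hFP j
    _ < ∞ := by
        rw [← ENNReal.ofReal_tsum_of_nonneg (fun j => by positivity)
          ((summable_geometric_of_lt_one hr0 hr1).mul_left _)]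
        exact ENNReal.add_lt_top.2 ⟨ENNReal.one_lt_top, ENNReal.ofReal_lt_top⟩

end upper

/-! ### Lower tail bound and infinite moments. -/

theorem survProb_shift {k : ℕ} (q : ℕ → ℝ) (d n : ℕ) : ∀ i r,
    survProb k q n (i + d) r = survProb k (fun j => q (j + d)) n i r := by
  induction n with
  | zero => intro i r; rfl
  | succ n ih =>
    intro i r
    simp only [survProb, ← ih]
    rw [add_right_comm]

section lower

variable {Ω : Type*} [MeasurableSpace Ω] {P : Measure Ω} [IsProbabilityMeasure P] {μ : ℝ → ℝ}
  {N : Ω → Set ℝ} {a : ℝ}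

theorem exists_le_survProb (ha : 0 < a) {b' : ℝ} (hab : a < b') :
    ∃ δ > 0, ∃ η < 1, ∀ᶠ t₀ : ℝ in atTop, ∀ L m : ℕ, 3 ≤ m →
      critRate a (t₀ + L + 2) / m ≤ δ →
      (1 - η) * (t₀ / (t₀ + L)) ^ b' ≤
        survProb (m - 2) (fun i => Real.exp (-(critRate a (t₀ + (i + 1 : ℕ) / m) / m)))
          (m * L + (m - 2)) 0 0 := by
  obtain ⟨b, hab', hbb'⟩ := exists_between hab
  have hb : 0 < b := ha.trans hab'
  have hb' : 0 < b' := ha.trans hab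
  obtain ⟨δ, hbδ, hδ⟩ : ∃ δ : ℝ, a * Real.exp (2 * δ) * (1 + δ) ≤ b ∧ 0 < δ := by
    have hc : Tendsto (fun δ : ℝ => a * Real.exp (2 * δ) * (1 + δ)) (nhdsWithin 0 (Ioi 0))
        (nhds a) := by
      have : Continuous (fun δ : ℝ => a * Real.exp (2 * δ) * (1 + δ)) := by fun_prop
      have := (this.tendsto 0).mono_left (nhdsWithin_le_nhds (s := Ioi 0))
      simpa using this
    exact ((hc.eventually_le_const hab').and self_mem_nhdsWithin).exists
  obtain ⟨ε, hε, hεb⟩ : ∃ ε : ℝ, 0 < ε ∧ (1 + ε) * b < b' :=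
    ⟨(b' - b) / (2 * b), div_pos (by linarith) (by linarith), by field_simp; linarith⟩
  -- Chosen so that `(1 + ε) * (1 - (2 + ε) * η) = 1`.
  set η : ℝ := ε / ((1 + ε) * (2 + ε)) with hη
  have hη0 : 0 < η := by positivity
  have hη1 : η < 1 := by
    rw [hη, div_lt_one (by positivity)]
    nlinarith
  have hηε : 1 ≤ (1 + ε) * (1 - (2 + ε) * η) := by
    refine le_of_eq ?_
    rw [hη]
    field_simp
    ring
  have hγ : 0 < 1 - (1 + ε) * b / b' := by
    rw [sub_pos, div_lt_one hb']
    exact hεb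
  refine ⟨δ, hδ, η, hη1, ?_⟩
  obtain ⟨t₁, ht₁⟩ := eventually_atTop.1 ((eventually_exp_mul_le ha hδ hbδ).and
    ((eventually_exp_le ha (δ := δ) hη0).and (eventually_log_le_critRate ha)))
  filter_upwards [eventually_ge_atTop t₁, eventually_gt_atTop 1, eventually_ge_atTop (b / η),
    eventually_ge_atTop ((1 + ε) * b / (1 - (1 + ε) * b / b'))] with t₀ h₀ h1 hbη hεγ L m hm3 hR
  have hm0 : 0 < (m : ℝ) := by exact_mod_cast (by omega : 0 < m)
  have hm1 : 1 ≤ (m : ℝ) := by exact_mod_cast (by omega : 1 ≤ m)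
  have hm2 : ((m - 2 : ℕ) : ℝ) = m - 2 := by rw [Nat.cast_sub (by omega)]; rfl
  have hcrit0 : ∀ t, t₀ ≤ t → 0 ≤ critRate a t := fun t ht =>
    (Real.log_pos (h1.trans_le ht)).le.trans (ht₁ t (h₀.trans ht)).2.2
  set q : ℕ → ℝ := fun i => Real.exp (-(critRate a (t₀ + (i + 1 : ℕ) / m) / m)) with hq
  have hq0 : ∀ i, 0 ≤ q i := fun i => (Real.exp_pos _).le
  have hq1 : ∀ i, q i ≤ 1 := fun i => Real.exp_le_one_iff.2
    (neg_nonpos.2 (div_nonneg (hcrit0 _ (le_add_of_nonneg_right (by positivity))) hm0.le))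
  have hmt : 0 < m * t₀ := by positivity
  have htc : t₀ ≤ m * t₀ + 1 := by nlinarith
  have hrun : ∀ i, i ≤ m * L → critRate a (t₀ + (i + 1 : ℕ) / m) / m ≤ δ ∧
      ∏ l ∈ Finset.range (m - 2), q (i + l) ≤
        Real.exp (-((m - 2) / m * critRate a (t₀ + (i + 1 : ℕ) / m))) := by
    intro i hi
    have hiL : ((i + 1 : ℕ) : ℝ) / m ≤ L + 1 := by
      rw [div_le_iff₀ hm0]
      have : (i : ℝ) ≤ m * L := by exact_mod_cast hi
      push_cast
      linarith
    have htt : t₀ ≤ t₀ + ((i + 1 : ℕ) : ℝ) / m := le_add_of_nonneg_right (by positivity)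
    constructor
    · refine le_trans ?_ hR
      gcongr
      exact critRate_mono (by linarith) (by linarith)
    · calc _ ≤ ∏ l ∈ Finset.range (m - 2), Real.exp (-(critRate a (t₀ + (i + 1 : ℕ) / m) / m)) := by
            refine Finset.prod_le_prod (fun _ _ => hq0 _) fun l _ => ?_
            simp only [hq]
            gcongr
            refine critRate_mono (by linarith) ?_
            gcongr
            omega
        _ = _ := by
            rw [Finset.prod_const, Finset.card_range, ← Real.exp_nat_mul, hm2]
            congr 1
            ring
  -- The offset is `c = m * t₀ + 1` because the rate is evaluated at `t₀ + (i + 1) / m`; then `c - 1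
  -- = m * t₀` gives the ratio wanted.
  have key := rpow_le_survProb hq0 hq1 (by omega : 0 < m - 2) hb.le hb'.le
    (by linarith : 1 < m * t₀ + 1) hε.le hη0.le (M := m * L + (m - 2)) ?_ ?_ ?_ hηε hη1.le ?_
    (m * L) 0 (by omega)
  · refine le_trans (le_of_eq ?_) key
    congr 2
    push_cast
    rw [add_zero, add_sub_cancel_right, ← mul_add, mul_div_mul_left _ _ hm0.ne']
  · intro i hi
    obtain ⟨hx, hQ⟩ := hrun i (by omega)
    exact hQ.trans ((ht₁ _ (h₀.trans (le_add_of_nonneg_right (by positivity)))).2.1 m hm0 hx)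
  · intro i hi
    obtain ⟨hx, hQ⟩ := hrun i (by omega)
    set t := t₀ + ((i + 1 : ℕ) : ℝ) / m with ht
    have htt : t₀ ≤ t := le_add_of_nonneg_right (by positivity)
    have hmain := (ht₁ t (h₀.trans htt)).1 m hm0 hx
    rw [show (m : ℝ) * t = m * t₀ + 1 + i by rw [ht]; push_cast; field_simp; ring] at hmain
    refine le_trans ?_ hmain
    refine mul_le_mul hQ ?_ (sub_nonneg.2 (hq1 _)) (Real.exp_pos _).le
    have e1 : 1 - q (i + (m - 2)) ≤ critRate a (t₀ + (i + (m - 2) + 1 : ℕ) / m) / m := by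
      simp only [hq]
      linarith [Real.add_one_le_exp (-(critRate a (t₀ + (i + (m - 2) + 1 : ℕ) / m) / m))]
    refine e1.trans ?_
    gcongr
    refine critRate_mono (h1.trans_le (le_add_of_nonneg_right (by positivity))) ?_
    rw [ht]
    push_cast
    rw [hm2]
    have : ((i : ℝ) + (m - 2) + 1) / m = (i + 1) / m + 1 - 2 / m := by field_simp; ring
    have : 0 < 2 / (m : ℝ) := by positivity
    linarith
  · rw [div_le_iff₀ (by linarith), hm2]
    rw [div_le_iff₀ hη0] at hbη
    nlinarith
  · have h2 : (1 + ε) * b / (m * t₀ + 1) ≤ 1 - (1 + ε) * b / b' := by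
      rw [div_le_iff₀ hγ] at hεγ
      rw [div_le_iff₀ (by linarith)]
      exact hεγ.trans (by rw [mul_comm]; gcongr)
    calc (1 + ε) * b = b' * ((1 + ε) * b / b') := by field_simp
      _ ≤ _ := by gcongr; linarith

/-- The end points of the cells of mesh `1 / 3` up to time `t₀` and of mesh `1 / m` afterwards. -/
noncomputable def cellEnd (t₀ m i : ℕ) : ℝ :=
  if i ≤ 3 * t₀ then (i : ℝ) / 3 else t₀ + ((i : ℝ) - 3 * t₀) / m

theorem cellEnd_of_le {t₀ m i : ℕ} (h : i ≤ 3 * t₀) : cellEnd t₀ m i = i / 3 := if_pos h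

theorem cellEnd_add (t₀ m i : ℕ) : cellEnd t₀ m (3 * t₀ + i) = t₀ + i / m := by
  unfold cellEnd
  split_ifs with h
  · obtain rfl : i = 0 := by omega
    push_cast
    ring
  · push_cast
    ring

theorem monotone_cellEnd (t₀ : ℕ) (m : ℕ) : Monotone (cellEnd t₀ m) := by
  refine monotone_nat_of_le_succ fun i => ?_
  rcases lt_or_ge i (3 * t₀) with h | h
  · rw [cellEnd_of_le (by omega), cellEnd_of_le (by omega)]
    gcongr
    omega
  · obtain ⟨j, rfl⟩ := Nat.exists_eq_add_of_le h
    rw [cellEnd_add, add_assoc, cellEnd_add]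
    gcongr
    omega

theorem cellEnd_nonneg (t₀ m i : ℕ) : 0 ≤ cellEnd t₀ m i := by
  have := monotone_cellEnd t₀ m (Nat.zero_le i)
  rwa [cellEnd_of_le (by omega), Nat.cast_zero, zero_div] at this

/-- If `x` lies in a fine cell, the next `m - 2` cells lie strictly between `x` and `x + 1`; a run
of `m - 1` could leave a point exactly at `x + 1`. If `x` is in a coarse cell, the next cell ends by
`x + 2 / 3`. After the last coarse cell this is the first fine one, hence `3 * t₀ + 1`. -/
theorem le_firstGap_of_surv {S : Set ℝ} {t₀ m L : ℕ} (hm : 3 ≤ m)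
    (h1 : Surv 1 (fun j => S ∩ Ioc (cellEnd t₀ m j) (cellEnd t₀ m (j + 1)) = ∅) (3 * t₀ + 1) 0 0)
    (h2 : Surv (m - 2) (fun j => S ∩ Ioc (cellEnd t₀ m j) (cellEnd t₀ m (j + 1)) = ∅)
      (m * L + (m - 2)) (3 * t₀ + 1) 0) :
    ENNReal.ofReal (t₀ + L) ≤ firstGap 1 S := by
  have hm0 : 0 < (m : ℝ) := by exact_mod_cast (by omega : 0 < m)
  have hm3 : (3 : ℝ) ≤ m := by exact_mod_cast hm
  have hm2 : ((m - 2 : ℕ) : ℝ) = m - 2 := by rw [Nat.cast_sub (by omega)]; rfl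
  refine le_firstGap fun x hx0 hx => ?_
  rcases lt_or_ge x t₀ with hxt | hxt
  · set i := ⌊3 * x⌋₊ with hi
    have hi1 : (i : ℝ) ≤ 3 * x := Nat.floor_le (by linarith)
    have hi2 : 3 * x < i + 1 := Nat.lt_floor_add_one _
    have hi3 : i < 3 * t₀ := by
      have : (i : ℝ) < (3 * t₀ : ℕ) := by push_cast; linarith
      exact_mod_cast this
    obtain ⟨j, hj1, hj2, hj⟩ := h1.exists_not (l := i + 1) (by omega) (by omega)
    obtain rfl : j = i + 1 := by omega
    obtain ⟨y, hy, hy1, hy2⟩ := nonempty_iff_ne_empty.2 hj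
    rw [cellEnd_of_le (by omega)] at hy1
    push_cast at hy1
    refine ⟨y, hy, by linarith, ?_⟩
    rcases (by omega : i + 2 ≤ 3 * t₀ ∨ i + 1 = 3 * t₀) with h | h
    · rw [cellEnd_of_le (by omega)] at hy2
      push_cast at hy2
      linarith
    · rw [h, cellEnd_add] at hy2
      have h3 : (i : ℝ) + 1 = 3 * t₀ := by exact_mod_cast h
      have h4 : ((1 : ℕ) : ℝ) / m ≤ 1 / 3 := by
        rw [Nat.cast_one]
        gcongr
      linarith
  · set j := ⌊m * (x - t₀)⌋₊ with hj
    have hj1 : (j : ℝ) ≤ m * (x - t₀) :=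
      Nat.floor_le (mul_nonneg hm0.le (by linarith))
    have hj2 : m * (x - t₀) < j + 1 := Nat.lt_floor_add_one _
    have hj3 : j ≤ m * L := by
      have : (j : ℝ) ≤ (m * L : ℕ) := by
        push_cast
        exact hj1.trans (by gcongr; linarith)
      exact_mod_cast this
    obtain ⟨l, hl1, hl2, hl⟩ := h2.exists_not (l := 3 * t₀ + (j + 1)) (by omega) (by omega)
    obtain ⟨l, rfl⟩ := Nat.exists_eq_add_of_le (by omega : 3 * t₀ ≤ l)
    obtain ⟨y, hy, hy1, hy2⟩ := nonempty_iff_ne_empty.2 hl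
    rw [cellEnd_add] at hy1
    rw [add_assoc, cellEnd_add] at hy2
    refine ⟨y, hy, ?_, ?_⟩
    · have : (j + 1 : ℝ) / m ≤ l / m := by
        gcongr
        exact_mod_cast (by omega : j + 1 ≤ l)
      have : x - t₀ < (j + 1) / m := by
        rw [lt_div_iff₀ hm0]
        linarith
      linarith
    · have h3 : ((l + 1 : ℕ) : ℝ) / m ≤ (j + (m - 1)) / m := by
        gcongr
        have : ((l + 1 : ℕ) : ℝ) ≤ (j + 1 + (m - 2 : ℕ) : ℕ) := by exact_mod_cast (by omega)
        refine this.trans_eq ?_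
        push_cast
        rw [hm2]
        ring
      have h4 : (j + (m - 1 : ℝ)) / m < x - t₀ + 1 := by
        rw [div_lt_iff₀ hm0]
        linarith
      linarith

/-- Coarse cells are all occupied with a probability `π > 0` independent of `m`, as `μ > 0` almost
everywhere. The first fine cell is occupied with probability at least `1 / (m + 1)`; this is the
only loss depending on the mesh. -/
theorem IsPoissonProcess.exists_le_tail (hN : IsPoissonProcess P μ N) (hμ : IsRateFunction μ)
    (ha : 0 < a) (h : ∀ᶠ t in atTop, critRate a t ≤ μ t) {b : ℝ} (hab : a < b) :
    ∃ δ > 0, ∃ κ > 0, ∃ t₀ : ℕ, 0 < t₀ ∧ ∀ L m : ℕ, 3 ≤ m →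
      critRate a (t₀ + L + 2) / m ≤ δ → ∃ F : Set Ω, MeasurableSet F ∧
        (∀ ω ∈ F, ENNReal.ofReal (t₀ + L) ≤ firstGap 1 (N ω)) ∧
        κ / (m + 1) * ((t₀ : ℝ) / (t₀ + L)) ^ b ≤ P.real F := by
  obtain ⟨δ, hδ, η, hη, hev⟩ := exists_le_survProb ha hab
  obtain ⟨t₁, ht₁⟩ := eventually_atTop.1 (hev.and (h.and
    ((eventually_log_le_critRate ha).and (Real.tendsto_log_atTop.eventually_ge_atTop 1))))
  set t₀ : ℕ := ⌈t₁⌉₊ + 2 with ht₀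
  have h₀ : t₁ ≤ t₀ := by
    rw [ht₀]
    push_cast
    linarith [Nat.le_ceil t₁]
  have h1 : (1 : ℝ) < t₀ := by exact_mod_cast (by omega : 1 < t₀)
  set π : ℝ := ∏ l ∈ Finset.range (3 * t₀),
    (1 - Real.exp (-(intensity μ (Ioc ((l : ℝ) / 3) ((l + 1 : ℕ) / 3))).toReal)) with hπ
  have hπ0 : 0 < π := by
    refine Finset.prod_pos fun l _ => sub_pos.2 (Real.exp_lt_one_iff.2 (neg_lt_zero.2 ?_))
    refine hμ.toReal_intensity_Ioc_pos (by positivity) ?_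
    gcongr
    omega
  refine ⟨δ, hδ, π * (1 - η), mul_pos hπ0 (sub_pos.2 hη), t₀, by omega, fun L m hm hR => ?_⟩
  have hS := (ht₁ t₀ h₀).1 L m hm hR
  have hm0 : 0 < (m : ℝ) := by exact_mod_cast (by omega : 0 < m)
  set s : ℕ → ℝ := cellEnd t₀ m with hs
  have hsm : Monotone s := monotone_cellEnd t₀ m
  have hs0 : ∀ i, 0 ≤ s i := cellEnd_nonneg t₀ m
  set E : ℕ → Set Ω := fun i => {ω | N ω ∩ Ioc (s i) (s (i + 1)) = ∅} with hE
  have hEm : ∀ i, MeasurableSet (E i) := fun i => hN.measurableSet_void measurableSet_Ioc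
  set q : ℕ → ℝ := fun i => Real.exp (-(intensity μ (Ioc (s i) (s (i + 1)))).toReal) with hq
  have hq0 : ∀ i, 0 ≤ q i := fun i => (Real.exp_pos _).le
  have hq1 : ∀ i, q i ≤ 1 := fun i =>
    Real.exp_le_one_iff.2 (neg_nonpos.2 ENNReal.toReal_nonneg)
  have hcrit1 : ∀ t : ℝ, t₀ ≤ t → 1 ≤ critRate a t := fun t ht =>
    (ht₁ t (h₀.trans ht)).2.2.2.trans (ht₁ t (h₀.trans ht)).2.2.1
  have hfine : ∀ i : ℕ, critRate a (t₀ + i / m) / m ≤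
      (intensity μ (Ioc (s (3 * t₀ + i)) (s (3 * t₀ + i + 1)))).toReal := by
    intro i
    have hti : (t₀ : ℝ) ≤ t₀ + i / m := le_add_of_nonneg_right (by positivity)
    rw [hs, add_assoc, cellEnd_add, cellEnd_add]
    refine le_trans (le_of_eq ?_) (hμ.le_toReal_intensity_Ioc (by positivity)
      (zero_le_one.trans (hcrit1 _ hti)) fun x hx => ?_)
    · push_cast
      field_simp
      ring
    · exact (critRate_mono (h1.trans_le hti) hx.1.le).trans
        (ht₁ x (h₀.trans (hti.trans hx.1.le))).2.1
  refine ⟨{ω | Surv 1 (fun j => ω ∈ E j) (3 * t₀ + 1) 0 0} ∩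
    {ω | Surv (m - 2) (fun j => ω ∈ E j) (m * L + (m - 2)) (3 * t₀ + 1) 0},
    (measurableSet_surv _ _ _ _ _ fun j _ _ => hEm j).inter
      (measurableSet_surv _ _ _ _ _ fun j _ _ => hEm j),
    fun ω hω => le_firstGap_of_surv hm hω.1 hω.2, ?_⟩
  rw [measureReal_surv_inter_surv hEm (hN.iIndepSet_void hsm)
    (fun j => hN.measureReal_void measurableSet_Ioc (hμ.intensity_Ioc_ne_top (hs0 j)))]
  have hfirst : π / (m + 1) ≤ survProb 1 q (3 * t₀ + 1) 0 0 := by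
    rw [survProb_one, Finset.prod_range_succ, div_eq_mul_inv]
    have e1 : ∏ l ∈ Finset.range (3 * t₀), (1 - q (0 + l)) = π := by
      refine Finset.prod_congr rfl fun l hl => ?_
      rw [Finset.mem_range] at hl
      simp only [hq, hs, zero_add]
      rw [cellEnd_of_le (by omega), cellEnd_of_le (by omega)]
    rw [e1]
    gcongr
    have e2 := hfine 0
    rw [Nat.cast_zero, zero_div, add_zero] at e2
    have e3 : 1 / (m : ℝ) ≤ critRate a t₀ / m := by
      gcongr
      exact hcrit1 _ le_rfl
    have e4 : q (0 + 3 * t₀) ≤ Real.exp (-(1 / (m : ℝ))) := by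
      simp only [hq, zero_add]
      gcongr
      exact e3.trans e2
    have e5 := div_one_add_le_one_sub_exp_neg (by positivity : 0 ≤ 1 / (m : ℝ))
    have e6 : 1 / (m : ℝ) / (1 + 1 / m) = ((m : ℝ) + 1)⁻¹ := by field_simp
    linarith
  have hsecond : (1 - η) * ((t₀ : ℝ) / (t₀ + L)) ^ b ≤
      survProb (m - 2) q (m * L + (m - 2)) (3 * t₀ + 1) 0 := by
    refine hS.trans ?_
    have hsh := survProb_shift (k := m - 2) q (3 * t₀ + 1) (m * L + (m - 2)) 0 0
    rw [zero_add] at hsh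
    rw [hsh]
    refine survProb_anti (fun i => hq0 _) (fun i => hq1 _) (fun i => (Real.exp_pos _).le)
      (fun i => ?_) (m * L + (m - 2)) (fun i _ => ?_) _ _ _ (by omega)
    · refine Real.exp_le_one_iff.2 (neg_nonpos.2 (div_nonneg (zero_le_one.trans (hcrit1 _ ?_))
        hm0.le))
      exact le_add_of_nonneg_right (by positivity)
    · simp only [hq]
      gcongr
      rw [show i + (3 * t₀ + 1) = 3 * t₀ + (i + 1) by omega]
      exact hfine (i + 1)
  calc π * (1 - η) / (m + 1) * ((t₀ : ℝ) / (t₀ + L)) ^ b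
      = π / (m + 1) * ((1 - η) * ((t₀ : ℝ) / (t₀ + L)) ^ b) := by ring
    _ ≤ _ := by
        refine mul_le_mul hfirst hsecond (mul_nonneg (by linarith) (by positivity)) ?_
        exact survProb_nonneg hq0 hq1 _ _ _

theorem IsPoissonProcess.gapMoment_eq_top (hN : IsPoissonProcess P μ N) (hμ : IsRateFunction μ)
    (ha : 0 < a) (h : ∀ᶠ t in atTop, critRate a t ≤ μ t) {p : ℝ} (hap : a < p) :
    gapMoment P 1 N p = ∞ := by
  obtain ⟨b, hab, hbp⟩ := exists_between hap
  have hp : 0 < p := ha.trans hap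
  obtain ⟨δ, hδ, κ, hκ, t₀, ht₀, htail⟩ := hN.exists_le_tail hμ ha h hab
  have ht₀' : (0 : ℝ) < t₀ := by exact_mod_cast ht₀
  by_contra hfin
  set G := (gapMoment P 1 N p).toReal with hG
  -- Markov's inequality for the event `F` on which `D ≥ t₀ + L`.
  have hmoment : ∀ L m : ℕ, 3 ≤ m → critRate a (t₀ + L + 2) / m ≤ δ →
      κ * (t₀ : ℝ) ^ b * ((t₀ : ℝ) + L) ^ (p - b) ≤ G * (m + 1) := by
    intro L m hm hR
    obtain ⟨F, hF, hFD, hFP⟩ := htail L m hm hR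
    set T : ℝ := t₀ + L with hT
    have hT0 : 0 < T := by positivity
    have h1 : ENNReal.ofReal (T ^ p) * P F ≤ gapMoment P 1 N p := by
      rw [← lintegral_indicator_const hF]
      refine lintegral_mono fun ω => ?_
      by_cases hω : ω ∈ F
      · rw [indicator_of_mem hω, ← ENNReal.ofReal_rpow_of_nonneg hT0.le hp.le]
        exact ENNReal.rpow_le_rpow (hFD ω hω) hp.le
      · rw [indicator_of_notMem hω]
        exact zero_le
    have h2 := ENNReal.toReal_mono hfin h1
    rw [ENNReal.toReal_mul, ENNReal.toReal_ofReal (by positivity)] at h2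
    have h3 : T ^ p * (κ / (m + 1) * (t₀ / T) ^ b) ≤ G :=
      (mul_le_mul_of_nonneg_left hFP (by positivity)).trans h2
    have h4 : κ * (t₀ : ℝ) ^ b * T ^ (p - b) = T ^ p * (κ / (m + 1) * (t₀ / T) ^ b) * (m + 1) := by
      rw [Real.div_rpow ht₀'.le hT0.le, Real.rpow_sub hT0]
      field_simp
    rw [h4]
    gcongr
  have hG0 : 0 ≤ G := ENNReal.toReal_nonneg
  set K := κ * (t₀ : ℝ) ^ b with hK
  have hK0 : 0 < K := by positivity
  have hlog : ∀ᶠ L : ℕ in atTop, K * ((t₀ : ℝ) + L) ^ (p - b) ≤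
      G * (2 * Real.log (t₀ + L + 1) / δ + 5) := by
    have hu : Tendsto (fun L : ℕ => (t₀ : ℝ) + L + 1) atTop atTop :=
      tendsto_atTop_add_const_right _ _ (tendsto_atTop_add_const_left _ _
        tendsto_natCast_atTop_atTop)
    filter_upwards [hu.eventually (eventually_critRate_add_one_le a one_pos)] with L hL
    rw [add_assoc _ (1 : ℝ) 1, one_add_one_eq_two] at hL
    -- A mesh of logarithmic order suffices, so the loss `m + 1` cannot offset the growth of `(t₀ +
    -- L) ^ (p - b)`.
    set m : ℕ := ⌈2 * Real.log (t₀ + L + 1) / δ⌉₊ + 3 with hm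
    have hm0 : 0 < (m : ℝ) := by positivity
    have hl0 : 0 ≤ Real.log (t₀ + L + 1) := Real.log_nonneg (le_add_of_nonneg_left (by positivity))
    refine (hmoment L m (by omega) ?_).trans ?_
    · rw [div_le_iff₀ hm0, ← div_le_iff₀' hδ, hm]
      push_cast
      calc critRate a (t₀ + L + 2) / δ ≤ 2 * Real.log (t₀ + L + 1) / δ := by
            gcongr
        _ ≤ _ := by linarith [Nat.le_ceil (2 * Real.log (t₀ + L + 1) / δ)]
    · refine mul_le_mul_of_nonneg_left ?_ hG0
      rw [hm]
      push_cast
      linarith [Nat.ceil_lt_add_one (by positivity : 0 ≤ 2 * Real.log (t₀ + L + 1) / δ)]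
  have hlim : Tendsto (fun x : ℝ => G * (2 * Real.log (x + 1) / δ + 5) / x ^ (p - b)) atTop
      (nhds 0) := by
    have hθ : 0 < p - b := by linarith
    have l1 : Tendsto (fun x : ℝ => 1 / x ^ (p - b)) atTop (nhds 0) := by
      simpa [Pi.inv_def] using (tendsto_rpow_atTop hθ).inv_tendsto_atTop
    have l2 : Tendsto (fun x : ℝ => Real.log x / x ^ (p - b)) atTop (nhds 0) :=
      (isLittleO_log_rpow_atTop hθ).tendsto_div_nhds_zero
    have l3 : Tendsto (fun x : ℝ => Real.log (x + 1) - Real.log x) atTop (nhds 0) := by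
      simpa using Real.tendsto_log_comp_add_sub_log 1
    have l4 := (((l3.mul l1).add l2).const_mul (G * 2 / δ)).add (l1.const_mul (G * 5))
    simp only [mul_zero, add_zero] at l4
    refine l4.congr fun x => ?_
    ring
  have hx : Tendsto (fun L : ℕ => (t₀ : ℝ) + L) atTop atTop :=
    tendsto_atTop_add_const_left _ _ tendsto_natCast_atTop_atTop
  obtain ⟨L, hL1, hL2⟩ := (hlog.and ((hlim.comp hx).eventually_lt_const hK0)).exists
  simp only [Function.comp_apply] at hL2
  rw [div_lt_iff₀ (by positivity)] at hL2
  linarith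

end lower

theorem mainTheorem10 (a : ℝ) (ha : 0 < a) (μ : ℝ → ℝ) (hμ : IsRateFunction μ)
    (hμa : ∀ᶠ t in atTop, μ t = Real.log t + Real.log (Real.log t) - Real.log a) :
    (∀ (Ω : Type*) [MeasurableSpace Ω] (P : Measure Ω) [IsProbabilityMeasure P] (N : Ω → Set ℝ),
      IsPoissonProcess P μ N →
        (∀ p : ℝ, 0 ≤ p → p < a → gapMoment P 1 N p < ∞) ∧
        (∀ p : ℝ, a < p → gapMoment P 1 N p = ∞)) ∧
    (∀ (μ' : ℝ → ℝ), IsRateFunction μ' →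
      ∀ (Ω' : Type*) [MeasurableSpace Ω'] (P' : Measure Ω') [IsProbabilityMeasure P']
        (N' : Ω' → Set ℝ), IsPoissonProcess P' μ' N' →
        ((∀ᶠ t in atTop, μ' t ≤ μ t) → ∀ p : ℝ, 0 ≤ p → p < a → gapMoment P' 1 N' p < ∞) ∧
        ((∀ᶠ t in atTop, μ t ≤ μ' t) → ∀ p : ℝ, a < p → gapMoment P' 1 N' p = ∞)) := by
  refine ⟨fun Ω _ P _ N hN => ⟨fun p hp hpa => ?_, fun p hpa => ?_⟩,
    fun μ' hμ' Ω' _ P' _ N' hN' => ⟨fun h p hp hpa => ?_, fun h p hpa => ?_⟩⟩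
  · exact hN.gapMoment_lt_top hμ ha (hμa.mono fun t ht => ht.le) hp hpa
  · exact hN.gapMoment_eq_top hμ ha (hμa.mono fun t ht => ht.ge) hpa
  · exact hN'.gapMoment_lt_top hμ' ha
      ((h.and hμa).mono fun t ht => ht.1.trans_eq ht.2) hp hpa
  · exact hN'.gapMoment_eq_top hμ' ha
      ((h.and hμa).mono fun t ht => ht.2.symm.trans_le ht.1) hpa
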